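/- Setting. Let $d\ge 0$ and $r:\mathbb Z^d\to(0,\infty)$ with $r(h)\to\infty$ as $\|h\|_2\to\infty$. On the torus $\mathbb T^d=(\mathbb R/\mathbb Z)^d$ with normalised Lebesgue measure let $\hat f_h=\int_{\mathbb T^d} f(x)e^{-2\pi i\langle h,x\rangle}\,dx$, and let $H$ be the space of integrable functions $f:\mathbb T^d\to\mathbb C$ that are given at every point by their (unconditionally convergent) Fourier series, $f(x)=\sum_{h\in\mathbb Z^d}\hat f_h e^{2\pi i\langle h,x\rangle}$, and satisfy $\|f\|_H^2=\sum_{h\in\mathbb Z^d} r(h)|\hat f_h|^2<\infty$. The worst-case error of an algorithm $A$ is $e^{\mathrm{wor\text{-}app}}(A)=\sup_{f\in H,\ \|f\|_H\le1}\|f-Af\|_{L_2}\in[0,\infty]$. Let $n\ge1$ be an integer, $z\in\mathbb Z^d$, $x_k=\frac kn z \bmod 1$ for $k=0,\dots,n-1$, and $X=\{x_k\}_{k=0}^{n-1}$. Let $B\subseteq\mathbb Z^d$ be a nonempty set on which $X$ has the reconstructing property: $\langle h,z\rangle\not\equiv\langle h',z\rangle\pmod n$ for all distinct $h,h'\in B$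 (so $B$ is finite). For a finite multiset $J$ of elements of $\{0,\dots,n-1\}$, with $|J|$ counting repetitions, let the least squares approximation $S_B^{X_J}f$ be a minimiser of $\sum_{k\in J}|g(x_k)-f(x_k)|^2$ over $g\in\mathrm{span}\{e^{2\pi i\langle h,\cdot\rangle}\}_{h\in B}$. Finally let $\Phi_B=\big[e^{2\pi i\frac kn\langle h,z\rangle}/\sqrt{r(h)}\big]_{0\le k<n,\ h\notin B}$ and let $\|\Phi_B\|_2$ be its spectral norm, i.e. its operator norm $\ell_2\to\ell_2$. The quantities on the right-hand side of the bound below are understood in $[0,\infty]$. Theorem. Let $t\ge4$ and let $J$ be a multiset of $|J|:=\lceil 12|B|(\log|B|+t)\rceil$ independent, uniformly distributed random elements of $\{0,\dots,n-1\}$. Then with probability exceeding $1-3e^{-t}$ the least squares minimiser $S_B^{X_J}f$ is unique for every $f:\mathbb T^d\to\mathbb C$ and $$e^{\mathrm{wor\text{-}app}}(S_B^{X_J})^2\le\sup_{h\notin B}\frac1{r(h)}+\frac{42(\log|J|+t)}{|J|}\sum_{h\notin B}\frac1{r(h)}+\frac4n\|\Phi_B\|_2^2 .$$ Moreover $$\frac{6(\log|J|+t)}{|J|}\le\frac1{|B|}\le\frac{13(\log|J|+t)}{|J|}.$$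 -/

import Mathlib

open MeasureTheory ProbabilityTheory UnitAddTorus Filter
open scoped ENNReal

namespace LatticeLS

noncomputable section

/-- The normalised Haar (Lebesgue) measure on the torus `𝕋ᵈ = (ℝ/ℤ)ᵈ`. -/
def torusMeasure (d : ℕ) : Measure (UnitAddTorus (Fin d)) :=
  Measure.pi fun _ => AddCircle.haarAddCircle

/-- The Fourier coefficient `∫ f(x) exp(-2πi⟨h,x⟩) dx`. -/
def fourierCoef {d : ℕ} (f : UnitAddTorus (Fin d) → ℂ) (h : Fin d → ℤ) : ℂ :=
  ∫ x, f x * mFourier (-h) x ∂(torusMeasure d)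

/-- `‖f‖_H = (∑_h r(h) |f̂_h|²)^{1/2}`, with value `∞` if the series diverges. -/
def hNorm {d : ℕ} (r : (Fin d → ℤ) → ℝ) (f : UnitAddTorus (Fin d) → ℂ) : ℝ≥0∞ :=
  (∑' h, ENNReal.ofReal (r h * ‖fourierCoef f h‖ ^ 2)) ^ (1 / 2 : ℝ)

/-- The space `H`: functions on the torus which are given by their Fourier series (at every point,
since function values are sampled) and have finite `H`-norm. -/
def MemH {d : ℕ} (r : (Fin d → ℤ) → ℝ) (f : UnitAddTorus (Fin d) → ℂ) : Prop :=
  Integrable f (torusMeasure d) ∧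
    (∀ x, HasSum (fun h => fourierCoef f h * mFourier h x) (f x)) ∧ hNorm r f < ∞

/-- The worst-case error `sup_{‖f‖_H ≤ 1} ‖f - A f‖_{L₂}` of an algorithm `A`. -/
def worstCaseError {d : ℕ} (r : (Fin d → ℤ) → ℝ)
    (A : (UnitAddTorus (Fin d) → ℂ) → UnitAddTorus (Fin d) → ℂ) : ℝ≥0∞ :=
  ⨆ (f : UnitAddTorus (Fin d) → ℂ) (_ : MemH r f ∧ hNorm r f ≤ 1),
    eLpNorm (f - A f) 2 (torusMeasure d)

/-- The `k`-th point `(k/n) z mod 1` of the rank-1 lattice of size `n` generated by `z`. -/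
def latticePoint {d : ℕ} (n : ℕ) (z : Fin d → ℤ) (k : Fin n) : UnitAddTorus (Fin d) :=
  fun j => (((k : ℝ) / n * z j : ℝ) : UnitAddCircle)

/-- The lattice of size `n` generated by `z` has the reconstructing property on `B`. -/
def Reconstructing {d : ℕ} (n : ℕ) (z : Fin d → ℤ) (B : Set (Fin d → ℤ)) : Prop :=
  ∀ h ∈ B, ∀ h' ∈ B, h ≠ h' → ¬ (h ⬝ᵥ z ≡ h' ⬝ᵥ z [ZMOD n])

/-- The span of the exponentials `exp(2πi⟨h,·⟩)`, `h ∈ B`. -/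
def trigSpan {d : ℕ} (B : Set (Fin d → ℤ)) : Submodule ℂ (UnitAddTorus (Fin d) → ℂ) :=
  Submodule.span ℂ ((fun h : Fin d → ℤ => ⇑(mFourier h)) '' B)

/-- `g` minimises `∑_{k ∈ J} |g(x_k) - f(x_k)|²` over `trigSpan B`. The multiset `J` is given as a
finite family of indices, so that repeated elements count repeatedly. -/
def IsLeastSquares {d n m : ℕ} (z : Fin d → ℤ) (B : Set (Fin d → ℤ)) (J : Fin m → Fin n)
    (f g : UnitAddTorus (Fin d) → ℂ) : Prop :=
  g ∈ trigSpan B ∧ IsMinOn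
    (fun u : UnitAddTorus (Fin d) → ℂ =>
      ∑ i, ‖u (latticePoint n z (J i)) - f (latticePoint n z (J i))‖ ^ 2) (trigSpan B) g

/-- The least squares approximation `S_B^{X_J} f`: the minimiser (some minimiser, if there are
several). -/
def leastSquares {d n m : ℕ} (z : Fin d → ℤ) (B : Set (Fin d → ℤ)) (J : Fin m → Fin n)
    (f : UnitAddTorus (Fin d) → ℂ) : UnitAddTorus (Fin d) → ℂ :=
  Classical.epsilon (IsLeastSquares z B J f)

/-- The matrix `Φ_B = [exp(2πi (k/n) ⟨h,z⟩) / √r(h)]` with rows `k ∈ {0,…,n-1}` and columns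
`h ∉ B`. -/
def phiMatrix {d : ℕ} (r : (Fin d → ℤ) → ℝ) (n : ℕ) (z : Fin d → ℤ) (B : Set (Fin d → ℤ)) :
    Matrix (Fin n) ↥Bᶜ ℂ :=
  Matrix.of fun k h =>
    Complex.exp (2 * Real.pi * Complex.I * ((k : ℂ) / n) * ((h : Fin d → ℤ) ⬝ᵥ z : ℤ)) /
      (Real.sqrt (r h) : ℂ)

/-- The spectral norm (operator norm from `ℓ₂` to `ℓ₂`) of a matrix with finitely many rows and
possibly infinitely many columns: the supremum of `‖M x‖₂` over the finitely supported vectors `x`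
with `‖x‖₂ ≤ 1`. -/
def specNorm {κ ι : Type*} [Fintype κ] (M : Matrix κ ι ℂ) : ℝ≥0∞ :=
  ⨆ (x : ι →₀ ℂ) (_ : ∑ j ∈ x.support, ‖x j‖ ^ 2 ≤ 1),
    ENNReal.ofReal (Real.sqrt (∑ k, ‖∑ j ∈ x.support, M k j * x j‖ ^ 2))

end

end LatticeLS

/-!
The error of `f` splits by frequency. Frequencies outside `B` contribute at most `sup 1 / r(h)` to
the squared `L₂` error. On `B`, least squares reproduces the part of `f` with frequencies in `B`, so
the coefficients of the rest of the error are the least squares solution for the samples of the part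
of `f` with frequencies outside `B`. Write `L_J` for the sampled Fourier matrix with columns in `B`
and `Φ_J` for the sampled rows of `Φ_B`; if `L_J* L_J ≥ m / 3` and `Φ_J* Φ_J ≤ θ`, that contribution
is at most `3 θ / m` (`worstCaseError_sq_le`). The first inequality also makes `L_J` injective, which
gives uniqueness of the minimiser.

Both spectral inequalities are matrix Chernoff bounds for sums of independent rank-one operators. The
rows of the Fourier matrix form a tight frame by the reconstructing property
(`card_exists_sum_lt_le`). For `Φ_B`, which has infinitely many columns, the dimension factor has to
be replaced by the number `m` of samples; this is achieved by following `tr (exp S - 1)` instead of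
`tr (exp S)` (`sum_expTrace_sampleSum_le`, `card_exists_lt_le`).

The exponential moments are controlled without the Golden–Thompson inequality, because the summands
have rank one. For positive `C`, a unit vector `v` and `A = C + a v v*`, expanding powers of `A` into
words in `C` and `v v*` reduces everything to the moments `⟪v, C^i v⟫ ≥ 0`. Comparing words of equal
length gives the first, and Chebyshev's association inequality the second, of the bounds
`a ⟪v, e^C v⟫ ≤ tr e^A - tr e^C ≤ a ⟪v, e^A v⟫` and `⟪v, e^A v⟫ ≤ e^a ⟪v, e^C v⟫`
(`le_expTrace_add_smul_outerProduct`, `expTrace_add_smul_outerProduct_le`,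
`expForm_add_smul_outerProduct_le`). Averaging over `v` yields recursions for the expected trace
exponential in the number of samples, and Markov's inequality the tail bounds.
-/

namespace LatticeLS

/-! ### The trace exponential -/

section TraceExponential

variable {E : Type*} [NormedAddCommGroup E] [InnerProductSpace ℂ E]

/-- The operator `x ↦ ⟪v, x⟫ v`. -/
noncomputable def outerProduct (v : E) : E →ₗ[ℂ] E := (InnerProductSpace.rankOne ℂ v v).toLinearMap

theorem outerProduct_apply (v x : E) : outerProduct v x = inner ℂ v x • v := rfl

theorem isSymmetric_outerProduct (v : E) : (outerProduct v).IsSymmetric :=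
  InnerProductSpace.isSymmetric_rankOne_self v

theorem isSymmetric_add_smul_outerProduct {C : E →ₗ[ℂ] E} (hC : C.IsSymmetric) (a : ℝ) (v : E) :
    (C + (a : ℂ) • outerProduct v).IsSymmetric :=
  hC.add ((isSymmetric_outerProduct v).smul (by simp))

theorem re_inner_smul_outerProduct (a : ℝ) (v x : E) :
    (inner ℂ (((a : ℂ) • outerProduct v) x) x).re = a * ‖inner ℂ v x‖ ^ 2 := by
  rw [LinearMap.smul_apply, outerProduct_apply, inner_smul_left, inner_smul_left, Complex.conj_mul']
  simp [← Complex.ofReal_pow]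

variable [FiniteDimensional ℂ E]

/-- The real number `tr (exp T)`, written as a power series. -/
noncomputable def expTrace (T : E →ₗ[ℂ] E) : ℝ :=
  ∑' p : ℕ, (LinearMap.trace ℂ E (T ^ p)).re / p.factorial

/-- The real number `⟪v, exp T v⟫`, written as a power series. -/
noncomputable def expForm (T : E →ₗ[ℂ] E) (v : E) : ℝ :=
  ∑' p : ℕ, (inner ℂ v ((T ^ p) v)).re / p.factorial

variable {T : E →ₗ[ℂ] E} (hT : T.IsSymmetric)

theorem pow_apply_eigenvectorBasis (p : ℕ) (k : Fin (Module.finrank ℂ E)) :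
    (T ^ p) (hT.eigenvectorBasis rfl k) =
      ((hT.eigenvalues rfl k ^ p : ℝ) : ℂ) • hT.eigenvectorBasis rfl k := by
  induction p with
  | zero => simp
  | succ p ih =>
    rw [pow_succ', Module.End.mul_apply, ih, map_smul, hT.apply_eigenvectorBasis, smul_smul,
      pow_succ, Complex.ofReal_mul]
    rfl

theorem re_inner_pow_apply_self (p : ℕ) (v : E) :
    (inner ℂ v ((T ^ p) v)).re =
      ∑ k, ‖inner ℂ (hT.eigenvectorBasis rfl k) v‖ ^ 2 * hT.eigenvalues rfl k ^ p := by
  rw [← (hT.eigenvectorBasis rfl).sum_inner_mul_inner, Complex.re_sum]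
  refine Finset.sum_congr rfl fun k _ => ?_
  rw [← hT.pow p, pow_apply_eigenvectorBasis, inner_smul_left, Complex.conj_ofReal,
    ← inner_conj_symm v, mul_left_comm, Complex.conj_mul', ← Complex.ofReal_pow,
    ← Complex.ofReal_mul, Complex.ofReal_re, mul_comm]

theorem re_trace_pow (p : ℕ) :
    (LinearMap.trace ℂ E (T ^ p)).re = ∑ k, hT.eigenvalues rfl k ^ p := by
  rw [LinearMap.trace_eq_sum_inner _ (hT.eigenvectorBasis rfl), Complex.re_sum]
  refine Finset.sum_congr rfl fun k _ => ?_
  rw [pow_apply_eigenvectorBasis, inner_smul_right, inner_self_eq_norm_sq_to_K,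
    (hT.eigenvectorBasis rfl).norm_eq_one]
  simp [-Complex.ofReal_pow]

theorem hasSum_sum_mul_pow_div_factorial {κ : Type*} [Fintype κ] (c x : κ → ℝ) :
    HasSum (fun p : ℕ => (∑ k, c k * x k ^ p) / p.factorial) (∑ k, c k * Real.exp (x k)) := by
  simp_rw [Finset.sum_div, mul_div_assoc]
  refine hasSum_sum fun k _ => HasSum.mul_left _ ?_
  rw [Real.exp_eq_exp_ℝ]
  exact NormedSpace.expSeries_div_hasSum_exp (x k)

theorem expForm_hasSum {T : E →ₗ[ℂ] E} (hT : T.IsSymmetric) (v : E) :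
    HasSum (fun p : ℕ => (inner ℂ v ((T ^ p) v)).re / p.factorial) (expForm T v) := by
  simp_rw [expForm, re_inner_pow_apply_self hT]
  exact (hasSum_sum_mul_pow_div_factorial _ _).summable.hasSum

theorem expTrace_hasSum {T : E →ₗ[ℂ] E} (hT : T.IsSymmetric) :
    HasSum (fun p : ℕ => (LinearMap.trace ℂ E (T ^ p)).re / p.factorial) (expTrace T) := by
  simp_rw [expTrace, re_trace_pow hT]
  simpa using (hasSum_sum_mul_pow_div_factorial (fun _ => 1) _).summable.hasSum

theorem expForm_eq_sum (v : E) :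
    expForm T v = ∑ k, ‖inner ℂ (hT.eigenvectorBasis rfl k) v‖ ^ 2 *
      Real.exp (hT.eigenvalues rfl k) := by
  simp_rw [expForm, re_inner_pow_apply_self hT]
  exact (hasSum_sum_mul_pow_div_factorial _ _).tsum_eq

theorem expTrace_eq_sum : expTrace T = ∑ k, Real.exp (hT.eigenvalues rfl k) := by
  simp_rw [expTrace, re_trace_pow hT]
  simpa using (hasSum_sum_mul_pow_div_factorial (fun _ => 1) (hT.eigenvalues rfl)).tsum_eq

/-- An operator whose quadratic form exceeds `τ` somewhere on the unit sphere has an eigenvalue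
above `τ`. -/
theorem exists_lt_eigenvalue {τ : ℝ} {x : E} (h : τ * ‖x‖ ^ 2 < (inner ℂ (T x) x).re) :
    ∃ k, τ < hT.eigenvalues rfl k := by
  by_contra! hle
  refine h.not_ge ?_
  have := re_inner_pow_apply_self hT 1 x
  rw [pow_one, ← hT] at this
  rw [this, ← (hT.eigenvectorBasis rfl).sum_sq_norm_inner_right x, Finset.mul_sum]
  refine Finset.sum_le_sum fun k _ => ?_
  rw [pow_one, mul_comm]
  exact mul_le_mul_of_nonneg_right (hle k) (sq_nonneg _)

end TraceExponential

/-! ### Rank-one perturbations -/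

section RankOnePerturbation

variable {E : Type*} [NormedAddCommGroup E] [InnerProductSpace ℂ E]

/-- Splitting one factor off the perturbed power in `⟪v, C^i (C + a v v*)^j v⟫`. -/
theorem inner_pow_mul_pow_succ (C : E →ₗ[ℂ] E) (a : ℝ) (v : E) (i j : ℕ) :
    inner ℂ v ((C ^ i) (((C + (a : ℂ) • outerProduct v) ^ (j + 1)) v)) =
      inner ℂ v ((C ^ (i + 1)) (((C + (a : ℂ) • outerProduct v) ^ j) v)) +
      a * (inner ℂ v (((C + (a : ℂ) • outerProduct v) ^ j) v) * inner ℂ v ((C ^ i) v)) := by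
  rw [pow_succ' (C + _), Module.End.mul_apply, LinearMap.add_apply, LinearMap.smul_apply,
    outerProduct_apply, map_add, inner_add_right, pow_succ C, Module.End.mul_apply,
    map_smul, map_smul, inner_smul_right, inner_smul_right]

/-- The mixed moment `⟪v, C^i (C + a v v*)^j v⟫`; for symmetric `C` it is real, so that taking the
real part loses nothing. -/
noncomputable def mixedMoment (C : E →ₗ[ℂ] E) (a : ℝ) (v : E) (i j : ℕ) : ℝ :=
  (inner ℂ v ((C ^ i) (((C + (a : ℂ) • outerProduct v) ^ j) v))).re

theorem inner_pow_apply_self_eq_ofReal {C : E →ₗ[ℂ] E} (hC : C.IsSymmetric) (i : ℕ) (v : E) :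
    inner ℂ v ((C ^ i) v) = (((inner ℂ v ((C ^ i) v)).re : ℝ) : ℂ) := by
  rw [← hC.pow i, eq_comm]
  exact (hC.pow i).coe_re_inner_apply_self v

theorem mixedMoment_zero_right (C : E →ₗ[ℂ] E) (a : ℝ) (v : E) (i : ℕ) :
    mixedMoment C a v i 0 = (inner ℂ v ((C ^ i) v)).re := by
  simp [mixedMoment]

theorem mixedMoment_succ {C : E →ₗ[ℂ] E} (hC : C.IsSymmetric) (a : ℝ) (v : E) (i j : ℕ) :
    mixedMoment C a v i (j + 1) = mixedMoment C a v (i + 1) j +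
      a * (mixedMoment C a v i 0 * mixedMoment C a v 0 j) := by
  rw [mixedMoment, inner_pow_mul_pow_succ, inner_pow_apply_self_eq_ofReal hC i,
    Complex.add_re, Complex.re_ofReal_mul, Complex.re_mul_ofReal, mixedMoment_zero_right,
    mul_comm (Complex.re _)]
  simp [mixedMoment]

variable [FiniteDimensional ℂ E] {C : E →ₗ[ℂ] E} {a : ℝ} {v : E}

theorem mixedMoment_nonneg (hC : C.IsPositive) (ha : 0 ≤ a) (i j : ℕ) :
    0 ≤ mixedMoment C a v i j := by
  induction j generalizing i with
  | zero =>
    rw [mixedMoment_zero_right, re_inner_pow_apply_self hC.isSymmetric]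
    exact Finset.sum_nonneg fun k _ =>
      mul_nonneg (sq_nonneg _) (pow_nonneg (hC.nonneg_eigenvalues rfl k) _)
  | succ j ih =>
    rw [mixedMoment_succ hC.isSymmetric]
    have h0 : 0 ≤ mixedMoment C a v i 0 := by
      rw [mixedMoment_zero_right, re_inner_pow_apply_self hC.isSymmetric]
      exact Finset.sum_nonneg fun k _ =>
        mul_nonneg (sq_nonneg _) (pow_nonneg (hC.nonneg_eigenvalues rfl k) _)
    exact add_nonneg (ih _) (mul_nonneg ha (mul_nonneg h0 (ih _)))

theorem mixedMoment_succ_left_le (hC : C.IsPositive) (ha : 0 ≤ a) (i j : ℕ) :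
    mixedMoment C a v (i + 1) j ≤ mixedMoment C a v i (j + 1) := by
  rw [mixedMoment_succ hC.isSymmetric, le_add_iff_nonneg_right]
  exact mul_nonneg ha (mul_nonneg (mixedMoment_nonneg hC ha _ _) (mixedMoment_nonneg hC ha _ _))

/-- Replacing factors `C` by `C + a v v*` increases the moment. -/
theorem mixedMoment_le_zero_left (hC : C.IsPositive) (ha : 0 ≤ a) (i j : ℕ) :
    mixedMoment C a v i j ≤ mixedMoment C a v 0 (i + j) := by
  induction i generalizing j with
  | zero => rw [zero_add]
  | succ i ih =>
    rw [show i + 1 + j = i + (j + 1) by ring]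
    exact (mixedMoment_succ_left_le hC ha i j).trans (ih _)

theorem mixedMoment_zero_right_le (hC : C.IsPositive) (ha : 0 ≤ a) (i j : ℕ) :
    mixedMoment C a v (i + j) 0 ≤ mixedMoment C a v i j := by
  induction j generalizing i with
  | zero => rw [add_zero]
  | succ j ih =>
    rw [show i + (j + 1) = i + 1 + j by ring]
    exact (ih _).trans (mixedMoment_succ_left_le hC ha i j)

/-- Chebyshev's association inequality for increasing functions of a probability distribution. -/
theorem sum_mul_sum_le_sum_of_monovary {κ : Type*} [Fintype κ] {c f g : κ → ℝ}
    (hc : ∀ k, 0 ≤ c k) (hc1 : ∑ k, c k = 1) (hfg : Monovary f g) :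
    (∑ k, c k * f k) * (∑ k, c k * g k) ≤ ∑ k, c k * (f k * g k) := by
  have h : 0 ≤ ∑ k, ∑ l, c k * c l * ((f k - f l) * (g k - g l)) :=
    Finset.sum_nonneg fun k _ => Finset.sum_nonneg fun l _ =>
      mul_nonneg (mul_nonneg (hc k) (hc l))
        (by rw [← smul_eq_mul]; exact monovary_iff_forall_smul_nonneg.1 hfg l k)
  have h2 : ∑ k, ∑ l, c k * c l * ((f k - f l) * (g k - g l)) =
      2 * ((∑ k, c k) * ∑ k, c k * (f k * g k) - (∑ k, c k * f k) * ∑ k, c k * g k) := by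
    have e : ∀ k l, c k * c l * ((f k - f l) * (g k - g l)) =
        c k * (f k * g k) * c l + c k * (c l * (f l * g l)) - c k * f k * (c l * g l)
          - c k * g k * (c l * f l) := fun k l => by ring
    simp_rw [e, Finset.sum_sub_distrib, Finset.sum_add_distrib, ← Finset.mul_sum,
      ← Finset.sum_mul]
    ring
  rw [h2, hc1] at h
  linarith

/-- The mixed moments are dominated by those in which `a v v*` is replaced by the scalar `a`. -/
theorem mixedMoment_le (hC : C.IsPositive) (ha : 0 ≤ a) (hv : ‖v‖ = 1) (i j : ℕ) :
    mixedMoment C a v i j ≤ ∑ k, ‖inner ℂ (hC.isSymmetric.eigenvectorBasis rfl k) v‖ ^ 2 *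
      (hC.isSymmetric.eigenvalues rfl k ^ i * (hC.isSymmetric.eigenvalues rfl k + a) ^ j) := by
  have hμ := fun k => hC.nonneg_eigenvalues rfl k
  induction j generalizing i with
  | zero => simp [mixedMoment_zero_right, re_inner_pow_apply_self hC.isSymmetric]
  | succ j ih =>
    set b := hC.isSymmetric.eigenvectorBasis rfl
    set μ := hC.isSymmetric.eigenvalues rfl
    rw [mixedMoment_succ hC.isSymmetric]
    have h1 : mixedMoment C a v i 0 = ∑ k, ‖inner ℂ (b k) v‖ ^ 2 * μ k ^ i := by
      rw [mixedMoment_zero_right, re_inner_pow_apply_self hC.isSymmetric]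
    have h2 : mixedMoment C a v i 0 * mixedMoment C a v 0 j ≤
        ∑ k, ‖inner ℂ (b k) v‖ ^ 2 * (μ k ^ i * (μ k + a) ^ j) := by
      refine (mul_le_mul_of_nonneg_left (ih 0) (mixedMoment_nonneg hC ha _ _)).trans ?_
      rw [h1]
      simp_rw [pow_zero, one_mul]
      refine sum_mul_sum_le_sum_of_monovary (fun k => sq_nonneg _) ?_ ?_
      · rw [b.sum_sq_norm_inner_right, hv, one_pow]
      · intro k l hkl
        have hkl' : μ k + a < μ l + a := lt_of_pow_lt_pow_left₀ j (add_nonneg (hμ l) ha) hkl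
        exact pow_le_pow_left₀ (hμ k) (by linarith) i
    refine (add_le_add (ih (i + 1)) (mul_le_mul_of_nonneg_left h2 ha)).trans_eq ?_
    rw [Finset.mul_sum, ← Finset.sum_add_distrib]
    exact Finset.sum_congr rfl fun k _ => by ring

theorem re_trace_pow_mul_pow_succ (hC : C.IsSymmetric) (a : ℝ) (v : E) (i j : ℕ) :
    (LinearMap.trace ℂ E (C ^ i * (C + (a : ℂ) • outerProduct v) ^ (j + 1))).re =
      (LinearMap.trace ℂ E (C ^ (i + 1) * (C + (a : ℂ) • outerProduct v) ^ j)).re +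
        a * mixedMoment C a v i j := by
  set A := C + (a : ℂ) • outerProduct v with hA
  have hAs : A.IsSymmetric := isSymmetric_add_smul_outerProduct hC a v
  have h : C ^ i * A ^ (j + 1) = C ^ (i + 1) * A ^ j +
      (a : ℂ) • ((innerₛₗ ℂ v ∘ₗ A ^ j).smulRight ((C ^ i) v)) := by
    ext x
    have hAx : A ((A ^ j) x) = C ((A ^ j) x) + (a : ℂ) • inner ℂ v ((A ^ j) x) • v := rfl
    rw [pow_succ' A, pow_succ C, Module.End.mul_apply, Module.End.mul_apply, hAx, map_add,
      map_smul, map_smul]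
    rfl
  rw [h, map_add, map_smul, LinearMap.trace_smulRight, Complex.add_re, smul_eq_mul,
    Complex.re_ofReal_mul, mixedMoment]
  congr 2
  rw [LinearMap.comp_apply, innerₛₗ_apply_apply, ← hAs.pow j, ← hC.pow i,
    ← inner_conj_symm, Complex.conj_re]

theorem re_trace_pow_mul_pow_le (hC : C.IsPositive) (ha : 0 ≤ a) (i j : ℕ) :
    (LinearMap.trace ℂ E (C ^ i * (C + (a : ℂ) • outerProduct v) ^ (j + 1))).re ≤
      (LinearMap.trace ℂ E (C ^ (i + j + 1))).re +
        a * ((j + 1 : ℕ) * mixedMoment C a v 0 (i + j)) := by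
  induction j generalizing i with
  | zero =>
    rw [re_trace_pow_mul_pow_succ hC.isSymmetric]
    simpa using mul_le_mul_of_nonneg_left (mixedMoment_le_zero_left hC ha i 0) ha
  | succ j ih =>
    rw [re_trace_pow_mul_pow_succ hC.isSymmetric]
    have h1 := ih (i + 1)
    have h2 := mul_le_mul_of_nonneg_left (mixedMoment_le_zero_left (v := v) hC ha i (j + 1)) ha
    rw [show i + 1 + j = i + (j + 1) by ring] at h1
    push_cast at h1 ⊢
    linarith

theorem le_re_trace_pow_mul_pow (hC : C.IsPositive) (ha : 0 ≤ a) (i j : ℕ) :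
    (LinearMap.trace ℂ E (C ^ (i + j + 1))).re +
        a * ((j + 1 : ℕ) * mixedMoment C a v (i + j) 0) ≤
      (LinearMap.trace ℂ E (C ^ i * (C + (a : ℂ) • outerProduct v) ^ (j + 1))).re := by
  induction j generalizing i with
  | zero =>
    rw [re_trace_pow_mul_pow_succ hC.isSymmetric]
    simp
  | succ j ih =>
    rw [re_trace_pow_mul_pow_succ hC.isSymmetric]
    have h1 := ih (i + 1)
    have h2 := mul_le_mul_of_nonneg_left (mixedMoment_zero_right_le (v := v) hC ha i (j + 1)) ha
    rw [show i + 1 + j = i + (j + 1) by ring] at h1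
    push_cast at h1 ⊢
    linarith

theorem expTrace_sub_finrank_hasSum {T : E →ₗ[ℂ] E} (hT : T.IsSymmetric) :
    HasSum (fun p : ℕ => (LinearMap.trace ℂ E (T ^ (p + 1))).re / (p + 1).factorial)
      (expTrace T - Module.finrank ℂ E) := by
  simpa using (hasSum_nat_add_iff' 1).2 (expTrace_hasSum hT)

theorem succ_mul_div_factorial_succ (a x : ℝ) (p : ℕ) :
    a * ((p + 1 : ℕ) * x) / (p + 1).factorial = a * (x / p.factorial) := by
  rw [Nat.factorial_succ, Nat.cast_mul]
  have := Nat.factorial_ne_zero p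
  field_simp

/-- The upper half of the convexity estimate for `tr exp` along a rank-one perturbation: the `p`-th
term of the series is compared with `a p ⟪v, (C + a v v*)^(p-1) v⟫`. -/
theorem expTrace_add_smul_outerProduct_le (hC : C.IsPositive) (ha : 0 ≤ a) :
    expTrace (C + (a : ℂ) • outerProduct v) ≤
      expTrace C + a * expForm (C + (a : ℂ) • outerProduct v) v := by
  have hA := isSymmetric_add_smul_outerProduct hC.isSymmetric a v
  have := hasSum_le (fun p => ?_) (expTrace_sub_finrank_hasSum hA)
    ((expTrace_sub_finrank_hasSum hC.isSymmetric).add ((expForm_hasSum hA v).mul_left a))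
  · linarith
  · rw [← succ_mul_div_factorial_succ, ← add_div]
    refine div_le_div_of_nonneg_right ?_ (Nat.cast_nonneg _)
    simpa [mixedMoment] using re_trace_pow_mul_pow_le (v := v) hC ha 0 p

theorem le_expTrace_add_smul_outerProduct (hC : C.IsPositive) (ha : 0 ≤ a) :
    expTrace C + a * expForm C v ≤ expTrace (C + (a : ℂ) • outerProduct v) := by
  have hA := isSymmetric_add_smul_outerProduct hC.isSymmetric a v
  have := hasSum_le (fun p => ?_) ((expTrace_sub_finrank_hasSum hC.isSymmetric).add
    ((expForm_hasSum hC.isSymmetric v).mul_left a)) (expTrace_sub_finrank_hasSum hA)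
  · linarith
  · rw [← succ_mul_div_factorial_succ, ← add_div]
    refine div_le_div_of_nonneg_right ?_ (Nat.cast_nonneg _)
    simpa [mixedMoment] using le_re_trace_pow_mul_pow (v := v) hC ha 0 p

/-- A substitute for the Golden–Thompson inequality: in `⟪v, exp (C + a v v*) v⟫`, the perturbation
may be replaced by the scalar `a ‖v‖² = a`. -/
theorem expForm_add_smul_outerProduct_le (hC : C.IsPositive) (ha : 0 ≤ a) (hv : ‖v‖ = 1) :
    expForm (C + (a : ℂ) • outerProduct v) v ≤ Real.exp a * expForm C v := by
  have hA := isSymmetric_add_smul_outerProduct hC.isSymmetric a v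
  rw [expForm_eq_sum hC.isSymmetric, Finset.mul_sum]
  have h := hasSum_sum_mul_pow_div_factorial
    (fun k => ‖inner ℂ (hC.isSymmetric.eigenvectorBasis rfl k) v‖ ^ 2)
    (fun k => hC.isSymmetric.eigenvalues rfl k + a)
  refine (hasSum_le (fun p => ?_) (expForm_hasSum hA v) h).trans_eq ?_
  · refine div_le_div_of_nonneg_right ?_ (Nat.cast_nonneg _)
    simpa [mixedMoment] using mixedMoment_le hC ha hv 0 p
  · exact Finset.sum_congr rfl fun k _ => by rw [Real.exp_add]; ring

end RankOnePerturbation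

/-! ### Tail bounds for random sums of rank-one projections -/

section RandomSums

variable {E : Type*} [NormedAddCommGroup E] [InnerProductSpace ℂ E] {κ : Type*} {m : ℕ}

/-- The sum of the rank-one operators `v_k v_k*` over the sampled indices `k = j 0, …, j (m - 1)`. -/
noncomputable def sampleSum (v : κ → E) (j : Fin m → κ) : E →ₗ[ℂ] E := ∑ i, outerProduct (v (j i))

theorem sampleSum_snoc (v : κ → E) (j : Fin m → κ) (k : κ) :
    sampleSum v (Fin.snoc j k : Fin (m + 1) → κ) = sampleSum v j + outerProduct (v k) := by
  simp [sampleSum, Fin.sum_univ_castSucc]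

theorem isSymmetric_sampleSum (v : κ → E) (j : Fin m → κ) : (sampleSum v j).IsSymmetric :=
  LinearMap.isSymmetric_sum _ fun _ _ => isSymmetric_outerProduct _

theorem re_inner_smul_sampleSum (a : ℝ) (v : κ → E) (j : Fin m → κ) (x : E) :
    (inner ℂ (((a : ℂ) • sampleSum v j) x) x).re = a * ∑ i, ‖inner ℂ (v (j i)) x‖ ^ 2 := by
  simp_rw [sampleSum, Finset.smul_sum, LinearMap.sum_apply, sum_inner, Complex.re_sum,
    re_inner_smul_outerProduct, Finset.mul_sum]

theorem isPositive_smul_sampleSum {a : ℝ} (ha : 0 ≤ a) (v : κ → E) (j : Fin m → κ) :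
    ((a : ℂ) • sampleSum v j).IsPositive := by
  refine ⟨(isSymmetric_sampleSum v j).smul (by simp), fun x => ?_⟩
  change 0 ≤ (inner ℂ (((a : ℂ) • sampleSum v j) x) x).re
  rw [re_inner_smul_sampleSum]
  exact mul_nonneg ha (Finset.sum_nonneg fun i _ => sq_nonneg _)

theorem re_inner_smul_one_sub (c a : ℝ) (v : κ → E) (j : Fin m → κ) (x : E) :
    (inner ℂ (((c : ℂ) • (1 : E →ₗ[ℂ] E) - (a : ℂ) • sampleSum v j) x) x).re =
      c * ‖x‖ ^ 2 - a * ∑ i, ‖inner ℂ (v (j i)) x‖ ^ 2 := by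
  rw [LinearMap.sub_apply, inner_sub_left, Complex.sub_re, re_inner_smul_sampleSum,
    LinearMap.smul_apply, Module.End.one_apply, inner_smul_left, Complex.conj_ofReal,
    Complex.re_ofReal_mul, inner_self_eq_norm_sq_to_K]
  simp [← Complex.ofReal_pow]

theorem isPositive_smul_one_sub {c a : ℝ} (ha : 0 ≤ a) (hc : a * m ≤ c) {v : κ → E}
    (hv : ∀ k, ‖v k‖ = 1) (j : Fin m → κ) :
    ((c : ℂ) • (1 : E →ₗ[ℂ] E) - (a : ℂ) • sampleSum v j).IsPositive := by
  refine ⟨(LinearMap.IsSymmetric.one.smul (by simp)).sub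
    ((isSymmetric_sampleSum v j).smul (by simp)), fun x => ?_⟩
  change 0 ≤ (inner ℂ (((c : ℂ) • (1 : E →ₗ[ℂ] E) - (a : ℂ) • sampleSum v j) x) x).re
  rw [re_inner_smul_one_sub, sub_nonneg]
  have h : ∑ i, ‖inner ℂ (v (j i)) x‖ ^ 2 ≤ m * ‖x‖ ^ 2 := by
    refine (Finset.sum_le_sum fun i _ => ?_).trans_eq (b := ∑ _i : Fin m, ‖x‖ ^ 2) (by simp)
    refine pow_le_pow_left₀ (norm_nonneg _) ?_ 2
    simpa [hv] using norm_inner_le_norm (𝕜 := ℂ) (v (j i)) x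
  calc a * ∑ i, ‖inner ℂ (v (j i)) x‖ ^ 2 ≤ a * (m * ‖x‖ ^ 2) := mul_le_mul_of_nonneg_left h ha
    _ = a * m * ‖x‖ ^ 2 := by ring
    _ ≤ c * ‖x‖ ^ 2 := mul_le_mul_of_nonneg_right hc (sq_nonneg _)

theorem sum_snoc [Fintype κ] (f : (Fin (m + 1) → κ) → ℝ) :
    ∑ j, f j = ∑ j : Fin m → κ, ∑ k, f (Fin.snoc j k) := by
  rw [← (Fin.snocEquiv fun _ : Fin (m + 1) => κ).sum_comp, Fintype.sum_prod_type_right]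
  rfl

variable [FiniteDimensional ℂ E]

theorem expTrace_smul_one (c : ℝ) :
    expTrace ((c : ℂ) • (1 : E →ₗ[ℂ] E)) = Module.finrank ℂ E * Real.exp c := by
  have h : ∀ p : ℕ, (LinearMap.trace ℂ E (((c : ℂ) • (1 : E →ₗ[ℂ] E)) ^ p)).re / p.factorial =
      Module.finrank ℂ E * (c ^ p / p.factorial) := fun p => by
    rw [smul_pow, one_pow, map_smul, LinearMap.trace_one, smul_eq_mul, ← Complex.ofReal_pow,
      Complex.re_ofReal_mul, Complex.natCast_re]
    ring
  rw [expTrace]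
  simp_rw [h]
  rw [tsum_mul_left, Real.exp_eq_exp_ℝ, (NormedSpace.expSeries_div_hasSum_exp c).tsum_eq]

theorem exp_eigenvalue_le_expTrace {T : E →ₗ[ℂ] E} (hT : T.IsSymmetric)
    (k : Fin (Module.finrank ℂ E)) : Real.exp (hT.eigenvalues rfl k) ≤ expTrace T := by
  rw [expTrace_eq_sum hT]
  exact Finset.single_le_sum (f := fun k => Real.exp (hT.eigenvalues rfl k))
    (fun _ _ => (Real.exp_pos _).le) (Finset.mem_univ k)

theorem expTrace_nonneg {T : E →ₗ[ℂ] E} (hT : T.IsSymmetric) : 0 ≤ expTrace T := by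
  rw [expTrace_eq_sum hT]
  exact Finset.sum_nonneg fun _ _ => (Real.exp_pos _).le

theorem expTrace_sub_finrank {T : E →ₗ[ℂ] E} (hT : T.IsSymmetric) :
    expTrace T - Module.finrank ℂ E = ∑ k, (Real.exp (hT.eigenvalues rfl k) - 1) := by
  rw [expTrace_eq_sum hT, Finset.sum_sub_distrib]
  simp

theorem exp_eigenvalue_sub_one_le {T : E →ₗ[ℂ] E} (hT : T.IsPositive)
    (k : Fin (Module.finrank ℂ E)) :
    Real.exp (hT.isSymmetric.eigenvalues rfl k) - 1 ≤ expTrace T - Module.finrank ℂ E := by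
  rw [expTrace_sub_finrank hT.isSymmetric]
  exact Finset.single_le_sum (f := fun k => Real.exp (hT.isSymmetric.eigenvalues rfl k) - 1)
    (fun l _ => sub_nonneg.2 (Real.one_le_exp (hT.nonneg_eigenvalues rfl l))) (Finset.mem_univ k)

theorem finrank_le_expTrace {T : E →ₗ[ℂ] E} (hT : T.IsPositive) :
    0 ≤ expTrace T - Module.finrank ℂ E := by
  rw [expTrace_sub_finrank hT.isSymmetric]
  exact Finset.sum_nonneg fun l _ =>
    sub_nonneg.2 (Real.one_le_exp (hT.nonneg_eigenvalues rfl l))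

variable [Fintype κ] {v : κ → E} {a : ℝ}

theorem sum_expForm {T : E →ₗ[ℂ] E} (hT : T.IsSymmetric) (v : κ → E) :
    ∑ k, expForm T (v k) = ∑ l, Real.exp (hT.eigenvalues rfl l) *
      ∑ k, ‖inner ℂ (v k) (hT.eigenvectorBasis rfl l)‖ ^ 2 := by
  simp_rw [expForm_eq_sum hT, Finset.mul_sum]
  rw [Finset.sum_comm]
  refine Finset.sum_congr rfl fun l _ => Finset.sum_congr rfl fun k _ => ?_
  rw [norm_inner_symm, mul_comm]

/-- The eigenvalues of `exp T` are split as `(exp μ - 1) + 1`; the first part sees the spectral bound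
`s` of the frame operator, the second only its trace, which is the number of vectors. -/
theorem sum_expForm_le {T : E →ₗ[ℂ] E} (hT : T.IsPositive) (hv : ∀ k, ‖v k‖ = 1) {s : ℝ}
    (hs : ∀ x, ∑ k, ‖inner ℂ (v k) x‖ ^ 2 ≤ s * ‖x‖ ^ 2) :
    ∑ k, expForm T (v k) ≤ s * (expTrace T - Module.finrank ℂ E) + Fintype.card κ := by
  have hcard : (Fintype.card κ : ℝ) =
      ∑ l, ∑ k, ‖inner ℂ (v k) (hT.isSymmetric.eigenvectorBasis rfl l)‖ ^ 2 := by
    rw [Finset.sum_comm]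
    simp_rw [OrthonormalBasis.sum_sq_norm_inner_left, hv]
    simp
  rw [sum_expForm hT.isSymmetric, expTrace_sub_finrank hT.isSymmetric, hcard, Finset.mul_sum,
    ← Finset.sum_add_distrib]
  refine Finset.sum_le_sum fun l _ => ?_
  have h1 := hs (hT.isSymmetric.eigenvectorBasis rfl l)
  rw [OrthonormalBasis.norm_eq_one, one_pow, mul_one] at h1
  have h2 := mul_le_mul_of_nonneg_left h1
    (sub_nonneg.2 (Real.one_le_exp (hT.nonneg_eigenvalues rfl l)))
  linarith

/-- Averaging the effect of one more random summand on `tr (exp T - 1)`. -/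
theorem sum_expTrace_add_le {T : E →ₗ[ℂ] E} (hT : T.IsPositive) (ha : 0 ≤ a)
    (hv : ∀ k, ‖v k‖ = 1) {s : ℝ} (hs : ∀ x, ∑ k, ‖inner ℂ (v k) x‖ ^ 2 ≤ s * ‖x‖ ^ 2) :
    ∑ k, (expTrace (T + (a : ℂ) • outerProduct (v k)) - Module.finrank ℂ E) ≤
      (Fintype.card κ + a * Real.exp a * s) * (expTrace T - Module.finrank ℂ E) +
        a * Real.exp a * Fintype.card κ := by
  have h1 : ∀ k, expTrace (T + (a : ℂ) • outerProduct (v k)) - Module.finrank ℂ E ≤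
      (expTrace T - Module.finrank ℂ E) + a * Real.exp a * expForm T (v k) := fun k => by
    have h2 := expTrace_add_smul_outerProduct_le (v := v k) hT ha
    have h3 := mul_le_mul_of_nonneg_left (expForm_add_smul_outerProduct_le hT ha (hv k)) ha
    linarith
  refine (Finset.sum_le_sum fun k _ => h1 k).trans ?_
  rw [Finset.sum_add_distrib, ← Finset.mul_sum]
  have h4 := mul_le_mul_of_nonneg_left (sum_expForm_le hT hv hs)
    (mul_nonneg ha (Real.exp_pos a).le)
  simp only [Finset.sum_const, Finset.card_univ, nsmul_eq_mul]
  linarith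

/-- The intrinsic-dimension form of the exponential moment bound: the factor `m` on the right-hand
side replaces the dimension of `E`. -/
theorem sum_expTrace_sampleSum_le (ha : 0 ≤ a) (hv : ∀ k, ‖v k‖ = 1) {s : ℝ} (hs0 : 0 ≤ s)
    (hs : ∀ x, ∑ k, ‖inner ℂ (v k) x‖ ^ 2 ≤ s * ‖x‖ ^ 2) (m : ℕ) :
    (∑ j : Fin m → κ, (expTrace ((a : ℂ) • sampleSum v j) - Module.finrank ℂ E)) ≤
      m * (a * Real.exp a) * (Fintype.card κ + a * Real.exp a * s) ^ m := by
  have hg : 0 ≤ a * Real.exp a := mul_nonneg ha (Real.exp_pos a).le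
  have hN : (0 : ℝ) ≤ Fintype.card κ := Nat.cast_nonneg _
  induction m with
  | zero =>
    have h := expTrace_smul_one (E := E) 0
    rw [Complex.ofReal_zero, zero_smul, Real.exp_zero, mul_one] at h
    simp [sampleSum, h]
  | succ m ih =>
    have hle : (Fintype.card κ : ℝ) ^ (m + 1) ≤ (Fintype.card κ + a * Real.exp a * s) ^ (m + 1) :=
      pow_le_pow_left₀ hN (le_add_of_nonneg_right (mul_nonneg hg hs0)) _
    rw [sum_snoc]
    simp_rw [sampleSum_snoc, smul_add]
    refine (Finset.sum_le_sum fun j _ => sum_expTrace_add_le (isPositive_smul_sampleSum ha v j) ha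
      hv hs).trans ?_
    rw [Finset.sum_add_distrib, ← Finset.mul_sum]
    have h1 := mul_le_mul_of_nonneg_left ih (add_nonneg hN (mul_nonneg hg hs0))
    have h2 := mul_le_mul_of_nonneg_left hle hg
    simp only [Finset.sum_const, Finset.card_univ, nsmul_eq_mul, Fintype.card_pi_const]
    push_cast
    rw [pow_succ] at h2 ⊢
    rw [pow_succ] at h2
    linarith

/-- Averaging the effect of removing one more random rank-one operator from `T`. -/
theorem sum_expTrace_sub_le {T : E →ₗ[ℂ] E} (hT : T.IsSymmetric) (ha : 0 ≤ a)
    (hv : ∀ k, ‖v k‖ = 1) {s : ℝ} (hs : ∀ x, ∑ k, ‖inner ℂ (v k) x‖ ^ 2 = s * ‖x‖ ^ 2)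
    (hTv : ∀ k, (T - (a : ℂ) • outerProduct (v k)).IsPositive) :
    ∑ k, expTrace (T - (a : ℂ) • outerProduct (v k)) ≤
      (Fintype.card κ - a * Real.exp (-a) * s) * expTrace T := by
  have h1 : ∀ k, expTrace (T - (a : ℂ) • outerProduct (v k)) ≤
      expTrace T - a * Real.exp (-a) * expForm T (v k) := fun k => by
    have h2 := le_expTrace_add_smul_outerProduct (v := v k) (hTv k) ha
    have h3 := expForm_add_smul_outerProduct_le (hTv k) ha (hv k)
    rw [sub_add_cancel] at h2 h3
    have h4 := mul_le_mul_of_nonneg_left h3 (mul_nonneg ha (Real.exp_pos (-a)).le)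
    have h5 : a * Real.exp (-a) * (Real.exp a * expForm (T - (a : ℂ) • outerProduct (v k)) (v k)) =
        a * expForm (T - (a : ℂ) • outerProduct (v k)) (v k) := by
      rw [← mul_assoc, mul_assoc a, ← Real.exp_add, neg_add_cancel, Real.exp_zero, mul_one]
    linarith
  refine (Finset.sum_le_sum fun k _ => h1 k).trans_eq ?_
  rw [Finset.sum_sub_distrib, ← Finset.mul_sum, sum_expForm hT, expTrace_eq_sum hT]
  simp_rw [hs, OrthonormalBasis.norm_eq_one]
  rw [← Finset.sum_mul]
  simp only [Finset.sum_const, Finset.card_univ, nsmul_eq_mul]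
  ring

/-- The exponential moment bound for the lower tail. The multiple `c` of the identity keeps all
operators positive, as the rank-one estimates require. -/
theorem sum_expTrace_smul_one_sub_le (ha : 0 ≤ a) (hv : ∀ k, ‖v k‖ = 1) {s : ℝ}
    (hs : ∀ x, ∑ k, ‖inner ℂ (v k) x‖ ^ 2 = s * ‖x‖ ^ 2)
    (hsa : a * Real.exp (-a) * s ≤ Fintype.card κ) {c : ℝ} (m : ℕ) (hc : a * m ≤ c) :
    (∑ j : Fin m → κ, expTrace ((c : ℂ) • (1 : E →ₗ[ℂ] E) - (a : ℂ) • sampleSum v j)) ≤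
      (Fintype.card κ - a * Real.exp (-a) * s) ^ m * (Module.finrank ℂ E * Real.exp c) := by
  induction m with
  | zero => simpa [sampleSum] using (expTrace_smul_one (E := E) c).le
  | succ m ih =>
    have hc' : a * m ≤ c := by push_cast at hc; linarith
    have hsub : ∀ (j : Fin m → κ) (k : κ),
        (c : ℂ) • (1 : E →ₗ[ℂ] E) - (a : ℂ) • sampleSum v (Fin.snoc j k : Fin (m + 1) → κ) =
          (c : ℂ) • 1 - (a : ℂ) • sampleSum v j - (a : ℂ) • outerProduct (v k) := fun j k => by
      rw [sampleSum_snoc, smul_add, sub_sub]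
    rw [sum_snoc]
    simp_rw [hsub]
    refine (Finset.sum_le_sum fun j _ => sum_expTrace_sub_le
      (isPositive_smul_one_sub ha hc' hv j).isSymmetric ha hv hs fun k => ?_).trans ?_
    · rw [← hsub]
      exact isPositive_smul_one_sub ha hc hv _
    · rw [← Finset.mul_sum, pow_succ', mul_assoc (_ - _)]
      exact mul_le_mul_of_nonneg_left (ih hc') (sub_nonneg.2 hsa)

/-- Markov's inequality for a uniformly distributed random element of a finite set. -/
theorem card_filter_mul_le_sum {ι : Type*} [Fintype ι] {U : ι → ℝ} (hU : ∀ j, 0 ≤ U j) {τ : ℝ}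
    {p : ι → Prop} [DecidablePred p] (hp : ∀ j, p j → τ ≤ U j) :
    (Finset.univ.filter p).card * τ ≤ ∑ j, U j := by
  rw [← nsmul_eq_mul]
  refine (Finset.card_nsmul_le_sum _ U τ fun j hj => hp j (Finset.mem_filter.1 hj).2).trans ?_
  exact Finset.sum_le_sum_of_subset_of_nonneg (Finset.filter_subset _ _) fun j _ _ => hU j

open Classical in
/-- Upper tail: few samples have a quadratic form exceeding `θ` somewhere on the unit sphere. -/
theorem card_exists_lt_sum_mul_le (ha : 0 < a) (hv : ∀ k, ‖v k‖ = 1) {s : ℝ} (hs0 : 0 ≤ s)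
    (hs : ∀ x, ∑ k, ‖inner ℂ (v k) x‖ ^ 2 ≤ s * ‖x‖ ^ 2) (m : ℕ) (θ : ℝ) :
    (Finset.univ.filter fun j : Fin m → κ =>
        ∃ x : E, θ * ‖x‖ ^ 2 < ∑ i, ‖inner ℂ (v (j i)) x‖ ^ 2).card * (Real.exp (a * θ) - 1) ≤
      m * (a * Real.exp a) * (Fintype.card κ + a * Real.exp a * s) ^ m := by
  refine (card_filter_mul_le_sum (fun j => finrank_le_expTrace
    (isPositive_smul_sampleSum ha.le v j)) ?_).trans (sum_expTrace_sampleSum_le ha.le hv hs0 hs m)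
  rintro j ⟨x, hx⟩
  have hpos := isPositive_smul_sampleSum ha.le v j
  obtain ⟨k, hk⟩ := exists_lt_eigenvalue hpos.isSymmetric (τ := a * θ) (x := x) (by
    rw [re_inner_smul_sampleSum, mul_assoc]
    exact mul_lt_mul_of_pos_left hx ha)
  exact (sub_le_sub_right (Real.exp_le_exp.2 hk.le) 1).trans (exp_eigenvalue_sub_one_le hpos k)

open Classical in
/-- Lower tail: few samples have a quadratic form below `θ` somewhere on the unit sphere. -/
theorem card_exists_sum_lt_mul_le (ha : 0 < a) (hv : ∀ k, ‖v k‖ = 1) {s : ℝ}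
    (hs : ∀ x, ∑ k, ‖inner ℂ (v k) x‖ ^ 2 = s * ‖x‖ ^ 2)
    (hsa : a * Real.exp (-a) * s ≤ Fintype.card κ) (m : ℕ) (θ : ℝ) :
    (Finset.univ.filter fun j : Fin m → κ =>
        ∃ x : E, ∑ i, ‖inner ℂ (v (j i)) x‖ ^ 2 < θ * ‖x‖ ^ 2).card *
          Real.exp (a * m - a * θ) ≤
      (Fintype.card κ - a * Real.exp (-a) * s) ^ m *
        (Module.finrank ℂ E * Real.exp (a * m)) := by
  have hpos := fun j : Fin m → κ => isPositive_smul_one_sub (E := E) ha.le le_rfl hv j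
  refine (card_filter_mul_le_sum (fun j => expTrace_nonneg (hpos j).isSymmetric) ?_).trans
    (sum_expTrace_smul_one_sub_le ha.le hv hs hsa m le_rfl)
  rintro j ⟨x, hx⟩
  obtain ⟨k, hk⟩ := exists_lt_eigenvalue (hpos j).isSymmetric (τ := a * m - a * θ) (x := x) (by
    rw [re_inner_smul_one_sub, sub_mul, mul_assoc a θ]
    exact sub_lt_sub_left (mul_lt_mul_of_pos_left hx ha) _)
  exact (Real.exp_le_exp.2 hk.le).trans (exp_eigenvalue_le_expTrace _ k)

end RandomSums

/-! ### Tail bounds with explicit constants -/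

section TailBounds

variable {F : Type*} [NormedAddCommGroup F] [InnerProductSpace ℂ F] {κ : Type*} [Fintype κ]

theorem measureReal_setOf_comp {n m : ℕ} (hn : 0 < n) {Ω : Type*} [MeasurableSpace Ω]
    (P : Measure Ω) [IsProbabilityMeasure P] (J : Fin m → Ω → Fin n)
    (hlaw : ∀ i, HasLaw (J i) (uniformOn Set.univ) P) (hindep : iIndepFun J P)
    (p : (Fin m → Fin n) → Prop) [DecidablePred p] :
    P.real {ω | p fun i => J i ω} = (Finset.univ.filter p).card / (n : ℝ) ^ m := by
  have hX : AEMeasurable (fun ω i => J i ω) P :=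
    aemeasurable_pi_iff.2 fun i => (hlaw i).aemeasurable
  have hmap : P.map (fun ω i => J i ω) =
      Measure.pi fun _ : Fin m => (uniformOn Set.univ : Measure (Fin n)) := by
    rw [(iIndepFun_iff_map_fun_eq_pi_map fun i => (hlaw i).aemeasurable).1 hindep]
    simp_rw [fun i => (hlaw i).map_eq]
  have : Nonempty (Fin n) := ⟨⟨0, hn⟩⟩
  have h1 : P {ω | p fun i => J i ω} = (P.map (fun ω i => J i ω)) ((Finset.univ.filter p : Finset _)) := by
    rw [Measure.map_apply_of_aemeasurable hX (Set.toFinite _).measurableSet]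
    congr 1
    ext ω
    simp
  rw [Measure.real, h1, hmap, ← sum_measure_singleton]
  simp [Measure.pi_singleton, uniformOn_univ, ENNReal.toReal_mul, div_eq_mul_inv]

theorem quarter_mul_exp_quarter_le : (1 / 4 : ℝ) * Real.exp (1 / 4) ≤ 1 / 3 := by
  have h : Real.exp (1 / 4) ^ 4 ≤ (4 / 3 : ℝ) ^ 4 := by
    rw [← Real.exp_nat_mul]
    norm_num
    exact Real.exp_one_lt_d9.le.trans (by norm_num)
  have := le_of_pow_le_pow_left₀ (by norm_num) (by norm_num) h
  linarith

theorem three_tenths_le_half_mul_exp : (3 / 10 : ℝ) ≤ 1 / 2 * Real.exp (-(1 / 2)) := by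
  have h : (Real.exp (1 / 2)) ^ 2 ≤ (5 / 3 : ℝ) ^ 2 := by
    rw [← Real.exp_nat_mul]
    norm_num
    exact Real.exp_one_lt_d9.le.trans (by norm_num)
  have h2 := le_of_pow_le_pow_left₀ (by norm_num) (by norm_num) h
  have h3 : (5 / 3 : ℝ)⁻¹ ≤ (Real.exp (1 / 2))⁻¹ := inv_anti₀ (Real.exp_pos _) h2
  rw [← Real.exp_neg] at h3
  norm_num at h3 ⊢
  linarith

theorem add_pow_le_mul_exp {N x : ℝ} (hN : 0 < N) (hx : 0 ≤ N + x) (m : ℕ) :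
    (N + x) ^ m ≤ N ^ m * Real.exp (x / N * m) := by
  have h : N + x ≤ N * Real.exp (x / N) := by
    have := mul_le_mul_of_nonneg_left (Real.add_one_le_exp (x / N)) hN.le
    rwa [mul_add, mul_div_cancel₀ _ hN.ne', mul_one, add_comm] at this
  refine (pow_le_pow_left₀ hx h m).trans_eq ?_
  rw [mul_pow, ← Real.exp_nat_mul, mul_comm (m : ℝ)]

open Classical in
/-- Upper tail for samples from unit vectors in a finite-dimensional space. -/
theorem card_exists_lt_le_of_norm_eq_one {E : Type*} [NormedAddCommGroup E] [InnerProductSpace ℂ E]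
    [FiniteDimensional ℂ E] [Nonempty κ] {v : κ → E} (hv : ∀ k, ‖v k‖ = 1) {Λ : ℝ} (hΛ : 0 ≤ Λ)
    (hs : ∀ x, ∑ k, ‖inner ℂ (v k) x‖ ^ 2 ≤ Fintype.card κ * Λ * ‖x‖ ^ 2) {m : ℕ} (hm : 0 < m)
    {t : ℝ} (ht : 1 ≤ t) :
    (Finset.univ.filter fun j : Fin m → κ => ∃ x : E,
        (14 * (Real.log m + t) + 4 / 3 * Λ * m) * ‖x‖ ^ 2 < ∑ i, ‖inner ℂ (v (j i)) x‖ ^ 2).card ≤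
      Real.exp (-t) * (Fintype.card κ : ℝ) ^ m := by
  set θ : ℝ := 14 * (Real.log m + t) + 4 / 3 * Λ * m with hθ
  have hN : (0 : ℝ) < Fintype.card κ := Nat.cast_pos.2 Fintype.card_pos
  have hm1 : (1 : ℝ) ≤ m := Nat.one_le_cast.2 hm
  have hlog : 0 ≤ Real.log m := Real.log_nonneg hm1
  -- With `a = 1 / 4` the growth rate `g = a e^a` per unit of `Λ` is at most `1 / 3 = a * (4 / 3)`,
  -- so the last term of `θ` absorbs the mean.
  have hmain := card_exists_lt_sum_mul_le (a := 1 / 4) (by norm_num) hv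
    (mul_nonneg hN.le hΛ) hs m θ
  set g : ℝ := 1 / 4 * Real.exp (1 / 4) with hg
  have hg0 : 0 ≤ g := by positivity
  have hg1 : g ≤ 1 / 3 := quarter_mul_exp_quarter_le
  have hpow : ((Fintype.card κ : ℝ) + g * (Fintype.card κ * Λ)) ^ m ≤
      (Fintype.card κ : ℝ) ^ m * Real.exp (1 / 3 * Λ * m) := by
    refine (add_pow_le_mul_exp hN (by positivity) m).trans ?_
    refine mul_le_mul_of_nonneg_left (Real.exp_le_exp.2 ?_) (by positivity)
    rw [show g * (Fintype.card κ * Λ) / Fintype.card κ = g * Λ by field_simp]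
    gcongr
  have hexp : m * g * Real.exp (1 / 3 * Λ * m) ≤ Real.exp (-t) * (Real.exp (1 / 4 * θ) - 1) := by
    have e1 : Real.exp (1 / 4 * θ) =
        Real.exp t * m * Real.exp (1 / 3 * Λ * m) * Real.exp (5 / 2 * (Real.log m + t)) := by
      have hml : (m : ℝ) = Real.exp (Real.log m) := (Real.exp_log (zero_lt_one.trans_le hm1)).symm
      have e0 : 1 / 4 * θ = t + Real.log m + 1 / 3 * Λ * m + 5 / 2 * (Real.log m + t) := by
        rw [hθ]
        ring
      rw [e0, Real.exp_add, Real.exp_add, Real.exp_add, ← hml]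
    have e2 : 2 ≤ Real.exp (5 / 2 * (Real.log m + t)) := by
      have := Real.add_one_le_exp (5 / 2 * (Real.log m + t))
      linarith
    have e3 : Real.exp (-t) * (Real.exp t * m * Real.exp (1 / 3 * Λ * m) * 2) =
        2 * (m * Real.exp (1 / 3 * Λ * m)) := by
      rw [Real.exp_neg]
      field_simp
    have e4 : 1 ≤ m * Real.exp (1 / 3 * Λ * m) :=
      one_le_mul_of_one_le_of_one_le hm1 (Real.one_le_exp (by positivity))
    have e5 : Real.exp (-t) * (Real.exp t * m * Real.exp (1 / 3 * Λ * m) * 2) ≤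
        Real.exp (-t) * Real.exp (1 / 4 * θ) := by
      rw [e1]
      gcongr
    have e6 : Real.exp (-t) ≤ 1 := Real.exp_le_one_iff.2 (by linarith)
    have e7 := mul_le_mul_of_nonneg_right hg1 (zero_le_one.trans e4)
    linarith
  have hpos : 0 < Real.exp (1 / 4 * θ) - 1 :=
    sub_pos.2 (Real.one_lt_exp_iff.2 (by positivity))
  refine le_of_mul_le_mul_right (hmain.trans ?_) hpos
  calc m * g * ((Fintype.card κ : ℝ) + g * (Fintype.card κ * Λ)) ^ m
      ≤ m * g * ((Fintype.card κ : ℝ) ^ m * Real.exp (1 / 3 * Λ * m)) := by gcongr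
    _ = m * g * Real.exp (1 / 3 * Λ * m) * (Fintype.card κ : ℝ) ^ m := by ring
    _ ≤ Real.exp (-t) * (Real.exp (1 / 4 * θ) - 1) * (Fintype.card κ : ℝ) ^ m := by gcongr
    _ = _ := by ring

open Classical in
/-- Upper tail for samples from vectors of equal norm `√T` in a space of arbitrary dimension: only
the finite-dimensional span of the vectors matters. -/
theorem card_exists_lt_le [Nonempty κ] {φ : κ → F} {T : ℝ} (hφ : ∀ k, ‖φ k‖ ^ 2 = T) {Λ : ℝ}
    (hΛ : 0 ≤ Λ) (hs : ∀ x, ∑ k, ‖inner ℂ (φ k) x‖ ^ 2 ≤ Fintype.card κ * Λ * ‖x‖ ^ 2) {m : ℕ}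
    (hm : 0 < m) {t : ℝ} (ht : 1 ≤ t) :
    (Finset.univ.filter fun j : Fin m → κ => ∃ x : F,
        (14 * (Real.log m + t) * T + 4 / 3 * Λ * m) * ‖x‖ ^ 2 <
          ∑ i, ‖inner ℂ (φ (j i)) x‖ ^ 2).card ≤
      Real.exp (-t) * (Fintype.card κ : ℝ) ^ m := by
  have hT : 0 ≤ T := hφ (Classical.arbitrary κ) ▸ sq_nonneg _
  have hm1 : (1 : ℝ) ≤ m := Nat.one_le_cast.2 hm
  have hlog : 0 ≤ Real.log m := Real.log_nonneg hm1
  rcases hT.eq_or_lt with rfl | hT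
  · have h0 : ∀ k, φ k = 0 := fun k => by simpa using hφ k
    rw [Finset.filter_false_of_mem]
    · simp only [Finset.card_empty, Nat.cast_zero]; positivity
    · rintro j - ⟨x, hx⟩
      simp only [h0, inner_zero_left, norm_zero] at hx
      refine hx.not_ge ?_
      simp only [ne_eq, OfNat.ofNat_ne_zero, not_false_eq_true, zero_pow, Finset.sum_const_zero]
      positivity
  · let E : Submodule ℂ F := Submodule.span ℂ (Set.range φ)
    have hE : ∀ k, φ k ∈ E := fun k => Submodule.subset_span ⟨k, rfl⟩
    have : FiniteDimensional ℂ E := FiniteDimensional.span_of_finite ℂ (Set.finite_range φ)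
    have hsq : 0 < √T := Real.sqrt_pos.2 hT
    let v : κ → E := fun k => ((√T)⁻¹ : ℂ) • ⟨φ k, hE k⟩
    have hv : ∀ k, ‖v k‖ = 1 := fun k => by
      have : ‖φ k‖ = √T := by rw [← hφ k, Real.sqrt_sq (norm_nonneg _)]
      rw [norm_smul, Submodule.coe_norm, this, norm_inv, Complex.norm_real, Real.norm_eq_abs,
        abs_of_pos hsq, inv_mul_cancel₀ hsq.ne']
    have hin : ∀ k (x : E), ‖inner ℂ (v k) x‖ ^ 2 = T⁻¹ * ‖inner ℂ (φ k) (x : F)‖ ^ 2 := by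
      intro k x
      rw [inner_smul_left, norm_mul, mul_pow, Submodule.coe_inner, RCLike.norm_conj, norm_inv,
        Complex.norm_real, Real.norm_eq_abs, abs_of_pos hsq, inv_pow, Real.sq_sqrt hT.le]
    have h := card_exists_lt_le_of_norm_eq_one hv (Λ := Λ / T) (by positivity) (fun x => by
      simp_rw [hin, ← Finset.mul_sum]
      calc T⁻¹ * ∑ k, ‖inner ℂ (φ k) (x : F)‖ ^ 2
          ≤ T⁻¹ * (Fintype.card κ * Λ * ‖(x : F)‖ ^ 2) := by gcongr; exact hs x
        _ = _ := by rw [Submodule.coe_norm]; ring) hm ht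
    refine le_trans ?_ h
    refine Nat.cast_le.2 (Finset.card_le_card fun j hj => ?_)
    simp only [Finset.mem_filter, Finset.mem_univ, true_and] at hj ⊢
    obtain ⟨x, hx⟩ := hj
    refine ⟨E.orthogonalProjectionOnto x, ?_⟩
    have hproj : ∀ k, inner ℂ (φ k) ((E.orthogonalProjectionOnto x : E) : F) = inner ℂ (φ k) x :=
      fun k =>
        E.inner_orthogonalProjectionOnto_eq_of_mem_left ⟨φ k, hE k⟩ x
    simp_rw [hin, hproj, ← Finset.mul_sum]
    have hle : ‖E.orthogonalProjectionOnto x‖ ^ 2 ≤ ‖x‖ ^ 2 :=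
      pow_le_pow_left₀ (norm_nonneg _) (E.norm_orthogonalProjectionOnto_apply_le x) 2
    calc (14 * (Real.log m + t) + 4 / 3 * (Λ / T) * m) * ‖E.orthogonalProjectionOnto x‖ ^ 2
        ≤ (14 * (Real.log m + t) + 4 / 3 * (Λ / T) * m) * ‖x‖ ^ 2 := by gcongr
      _ = T⁻¹ * ((14 * (Real.log m + t) * T + 4 / 3 * Λ * m) * ‖x‖ ^ 2) := by field_simp
      _ < _ := by gcongr

open Classical in
/-- Lower tail for samples from vectors forming a tight frame, with frame bound `n`. -/
theorem card_exists_sum_lt_le [Nonempty κ] [FiniteDimensional ℂ F] {φ : κ → F} {D : ℕ}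
    (hD : Module.finrank ℂ F = D) (hD0 : 0 < D) (hφ : ∀ k, ‖φ k‖ ^ 2 = D)
    (hs : ∀ x, ∑ k, ‖inner ℂ (φ k) x‖ ^ 2 = Fintype.card κ * ‖x‖ ^ 2) {m : ℕ} {t : ℝ} (ht : 0 ≤ t)
    (hm : 12 * D * (Real.log D + t) ≤ m) :
    (Finset.univ.filter fun j : Fin m → κ => ∃ x : F,
        ∑ i, ‖inner ℂ (φ (j i)) x‖ ^ 2 < m / 3 * ‖x‖ ^ 2).card ≤
      Real.exp (-t) * (Fintype.card κ : ℝ) ^ m := by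
  have hN : (0 : ℝ) < Fintype.card κ := Nat.cast_pos.2 Fintype.card_pos
  have hD1 : (1 : ℝ) ≤ D := Nat.one_le_cast.2 hD0
  have hDpos : (0 : ℝ) < D := zero_lt_one.trans_le hD1
  have hlog : 0 ≤ Real.log D := Real.log_nonneg hD1
  have hsq : 0 < √(D : ℝ) := Real.sqrt_pos.2 hDpos
  let v : κ → F := fun k => ((√(D : ℝ))⁻¹ : ℂ) • φ k
  have hv : ∀ k, ‖v k‖ = 1 := fun k => by
    have : ‖φ k‖ = √(D : ℝ) := by rw [← hφ k, Real.sqrt_sq (norm_nonneg _)]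
    rw [norm_smul, this, norm_inv, Complex.norm_real, Real.norm_eq_abs,
      abs_of_pos hsq, inv_mul_cancel₀ hsq.ne']
  have hin : ∀ k x, ‖inner ℂ (v k) x‖ ^ 2 = (D : ℝ)⁻¹ * ‖inner ℂ (φ k) x‖ ^ 2 := by
    intro k x
    rw [inner_smul_left, norm_mul, mul_pow, RCLike.norm_conj, norm_inv,
      Complex.norm_real, Real.norm_eq_abs, abs_of_pos hsq, inv_pow, Real.sq_sqrt hDpos.le]
  -- With `a = 1 / 2` the exponent is `-(b - 1 / 6) m / D`, and `12 (b - 1 / 6) ≥ 1`.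
  set b : ℝ := 1 / 2 * Real.exp (-(1 / 2)) with hb
  have hb0 : 3 / 10 ≤ b := three_tenths_le_half_mul_exp
  have hb1 : b ≤ 1 := by
    have : Real.exp (-(1 / 2)) ≤ 1 := Real.exp_le_one_iff.2 (by norm_num)
    rw [hb]
    linarith
  have hbD : b * (Fintype.card κ * (D : ℝ)⁻¹) ≤ Fintype.card κ := by
    have : b * (D : ℝ)⁻¹ ≤ 1 := mul_le_one₀ hb1 (by positivity) (inv_le_one_of_one_le₀ hD1)
    calc b * (Fintype.card κ * (D : ℝ)⁻¹) = Fintype.card κ * (b * (D : ℝ)⁻¹) := by ring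
      _ ≤ Fintype.card κ * 1 := by gcongr
      _ = _ := mul_one _
  have h := card_exists_sum_lt_mul_le (a := 1 / 2) (by norm_num) hv
    (s := Fintype.card κ * (D : ℝ)⁻¹) (fun x => by
      simp_rw [hin, ← Finset.mul_sum, hs]; ring) hbD m ((m : ℝ) / D / 3)
  have hset : (Finset.univ.filter fun j : Fin m → κ => ∃ x : F,
        ∑ i, ‖inner ℂ (φ (j i)) x‖ ^ 2 < m / 3 * ‖x‖ ^ 2) =
      Finset.univ.filter fun j : Fin m → κ => ∃ x : F,
        ∑ i, ‖inner ℂ (v (j i)) x‖ ^ 2 < m / D / 3 * ‖x‖ ^ 2 := by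
    refine Finset.filter_congr fun j _ => exists_congr fun x => ?_
    simp_rw [hin, ← Finset.mul_sum]
    rw [inv_mul_lt_iff₀ hDpos, show (D : ℝ) * (m / D / 3 * ‖x‖ ^ 2) = m / 3 * ‖x‖ ^ 2 by
      field_simp]
  rw [hset]
  refine le_of_mul_le_mul_right (h.trans ?_)
    (Real.exp_pos (1 / 2 * (m : ℝ) - 1 / 2 * ((m : ℝ) / D / 3)))
  have hpow : ((Fintype.card κ : ℝ) - b * (Fintype.card κ * (D : ℝ)⁻¹)) ^ m ≤
      (Fintype.card κ : ℝ) ^ m * Real.exp (-(b * (m / D))) := by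
    have := add_pow_le_mul_exp (x := -(b * (Fintype.card κ * (D : ℝ)⁻¹))) hN (by linarith) m
    rw [← sub_eq_add_neg] at this
    refine this.trans_eq ?_
    congr 2
    field_simp
  have hmD : 12 * (Real.log D + t) ≤ m / D := by
    rw [le_div_iff₀ hDpos]
    linarith
  rw [hD]
  calc ((Fintype.card κ : ℝ) - b * (Fintype.card κ * (D : ℝ)⁻¹)) ^ m *
        (D * Real.exp (1 / 2 * m))
      ≤ (Fintype.card κ : ℝ) ^ m * Real.exp (-(b * (m / D))) * (D * Real.exp (1 / 2 * m)) := by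
        gcongr
    _ = (Fintype.card κ : ℝ) ^ m * Real.exp (-(b * (m / D)) + (Real.log D + 1 / 2 * m)) := by
        rw [Real.exp_add, Real.exp_add (Real.log D), Real.exp_log hDpos]
        ring
    _ ≤ (Fintype.card κ : ℝ) ^ m *
        Real.exp (-t + (1 / 2 * (m : ℝ) - 1 / 2 * ((m : ℝ) / D / 3))) := by
        refine mul_le_mul_of_nonneg_left (Real.exp_le_exp.2 ?_) (by positivity)
        have := mul_le_mul_of_nonneg_right hb0 (a := (m : ℝ) / D) (by positivity)
        linarith
    _ = _ := by rw [Real.exp_add]; ring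

end TailBounds

/-! ### The number of samples -/

section SampleSize

variable {D m : ℕ} {t : ℝ}

theorem log_mul_twelve_le {s : ℝ} (hs : 4 ≤ s) : Real.log (12 * s) ≤ s := by
  have h : Real.log s ≤ Real.log 4 + (s / 4 - 1) := by
    have := Real.log_le_sub_one_of_pos (x := s / 4) (by linarith)
    rw [Real.log_div (by linarith) (by norm_num)] at this
    linarith
  have h48 : Real.log 12 + Real.log 4 ≤ 4 := by
    rw [← Real.log_mul (by norm_num) (by norm_num), Real.log_le_iff_le_exp (by norm_num)]
    have h1 : (2.7 : ℝ) ^ 4 ≤ Real.exp 1 ^ 4 :=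
      pow_le_pow_left₀ (by norm_num) (Real.exp_one_gt_d9.le.trans' (by norm_num)) 4
    rw [← Real.exp_nat_mul] at h1
    norm_num at h1 ⊢
    linarith
  rw [Real.log_mul (by norm_num) (by linarith)]
  linarith

/-- With `s = log D + t`, the first bound comes down to `log (12 s) ≤ s`, and rounding `12 D s` up
does not spoil it since `x - 6 D log x` increases for `x ≥ 6 D`. -/
theorem sample_size_bounds (hD : 0 < D) (ht : 4 ≤ t)
    (hm : m = ⌈12 * (D : ℝ) * (Real.log D + t)⌉₊) :
    6 * (Real.log m + t) / m ≤ 1 / (D : ℝ) ∧ 1 / (D : ℝ) ≤ 13 * (Real.log m + t) / m := by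
  have hD1 : (1 : ℝ) ≤ D := Nat.one_le_cast.2 hD
  have hDpos : (0 : ℝ) < D := zero_lt_one.trans_le hD1
  have hlog : 0 ≤ Real.log D := Real.log_nonneg hD1
  set s := Real.log D + t with hs
  have hs4 : 4 ≤ s := by linarith
  set x := 12 * (D : ℝ) * s with hx
  have hxD : 48 * D ≤ x := by rw [hx]; nlinarith
  have hmx : x ≤ m := hm ▸ Nat.le_ceil x
  have hmx' : (m : ℝ) < x + 1 := hm ▸ Nat.ceil_lt_add_one (by linarith)
  have hmpos : (0 : ℝ) < m := by linarith
  have hxpos : 0 < x := by linarith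
  constructor
  · rw [div_le_div_iff₀ hmpos hDpos, one_mul]
    have h1 : Real.log m ≤ Real.log x + (m - x) / x := by
      have := Real.log_le_sub_one_of_pos (x := m / x) (by positivity)
      rw [Real.log_div hmpos.ne' hxpos.ne'] at this
      rw [sub_div, div_self hxpos.ne']
      linarith
    have h2 : Real.log x ≤ Real.log D + s := by
      rw [hx, mul_assoc, mul_left_comm, Real.log_mul hDpos.ne' (by linarith)]
      linarith [log_mul_twelve_le hs4]
    have h3 : 6 * D * ((m - x) / x) ≤ m - x := by
      rw [mul_div_assoc', div_le_iff₀ hxpos, mul_comm]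
      exact mul_le_mul_of_nonneg_left (by linarith) (by linarith)
    have h4 : 6 * D * (Real.log m + t) ≤ 6 * D * ((m - x) / x + 2 * s) := by
      refine mul_le_mul_of_nonneg_left ?_ (by positivity)
      linarith
    linarith
  · rw [div_le_div_iff₀ hDpos hmpos, one_mul]
    have h1 : s ≤ Real.log m + t := by
      have := Real.log_le_log hDpos (show (D : ℝ) ≤ m by linarith)
      linarith
    have h2 : 13 * s * D ≤ 13 * (Real.log m + t) * D := by gcongr
    have h3 : 4 * (D : ℝ) ≤ s * D := by gcongr
    linarith

end SampleSize

/-! ### Exponentials on the torus and on the lattice -/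

section Exponentials

variable {d : ℕ}

theorem norm_mFourier_apply (h : Fin d → ℤ) (x : UnitAddTorus (Fin d)) : ‖mFourier h x‖ = 1 := by
  simp only [mFourier, fourier_apply, ContinuousMap.coe_mk, norm_prod, Circle.norm_coe,
    Finset.prod_const_one]

theorem mFourier_latticePoint (n : ℕ) (z h : Fin d → ℤ) (k : Fin n) :
    mFourier h (latticePoint n z k) =
      Complex.exp (2 * Real.pi * Complex.I * ((k : ℂ) / n) * (h ⬝ᵥ z : ℤ)) := by
  simp only [mFourier, latticePoint, ContinuousMap.coe_mk, fourier_coe_apply]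
  rw [← Complex.exp_sum]
  congr 1
  rw [dotProduct]
  push_cast
  rw [Finset.mul_sum]
  exact Finset.sum_congr rfl fun i _ => by ring

theorem sum_exp_mul_div_eq_zero {n : ℕ} (hn : 0 < n) {q : ℤ} (hq : ¬ (n : ℤ) ∣ q) :
    ∑ k : Fin n, Complex.exp (2 * Real.pi * Complex.I * ((k : ℂ) / n) * q) = 0 := by
  have hn0 : (n : ℂ) ≠ 0 := Nat.cast_ne_zero.2 hn.ne'
  set ω : ℂ := Complex.exp (2 * Real.pi * Complex.I * (q / n)) with hω
  have hpow : ∀ k : ℕ, Complex.exp (2 * Real.pi * Complex.I * ((k : ℂ) / n) * q) = ω ^ k := by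
    intro k
    rw [hω, ← Complex.exp_nat_mul]
    congr 1
    ring
  have h1 : ω ≠ 1 := by
    rw [hω, Ne, Complex.exp_eq_one_iff]
    rintro ⟨N, hN⟩
    refine hq ⟨N, ?_⟩
    have h2 : (q : ℂ) / n = N := by
      refine mul_left_cancel₀ Complex.two_pi_I_ne_zero ?_
      rw [hN]
      ring
    rw [div_eq_iff hn0] at h2
    rw [mul_comm]
    exact_mod_cast h2
  have hn1 : ω ^ n = 1 := by
    rw [← hpow n, div_self hn0, mul_one, mul_comm]
    exact Complex.exp_int_mul_two_pi_mul_I q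
  rw [Fin.sum_univ_eq_sum_range (fun k : ℕ =>
    Complex.exp (2 * Real.pi * Complex.I * ((k : ℂ) / n) * q)) n]
  simp_rw [hpow]
  rw [geom_sum_eq h1, hn1, sub_self, zero_div]

theorem sum_mFourier_mul_conj {n : ℕ} (hn : 0 < n) (z : Fin d → ℤ) {B : Set (Fin d → ℤ)}
    (hrec : Reconstructing n z B) [DecidableEq B] (h h' : B) :
    ∑ k : Fin n, mFourier h.1 (latticePoint n z k) *
      (starRingEnd ℂ) (mFourier h'.1 (latticePoint n z k)) = if h = h' then (n : ℂ) else 0 := by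
  split_ifs with heq
  · subst heq
    simp [Complex.mul_conj', norm_mFourier_apply]
  · have hne := hrec h h.2 h' h'.2 (fun e => heq (Subtype.ext e))
    rw [← sum_exp_mul_div_eq_zero hn (q := h.1 ⬝ᵥ z - h'.1 ⬝ᵥ z)
      (fun hd => hne (Int.modEq_iff_dvd.2 hd).symm)]
    refine Finset.sum_congr rfl fun k _ => ?_
    rw [← mFourier_neg, mFourier_latticePoint, mFourier_latticePoint, ← Complex.exp_add,
      neg_dotProduct]
    congr 1
    push_cast
    ring

/-- The map `h ↦ ⟨h, z⟩ mod n` is injective on `B`. -/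
theorem Reconstructing.finite {n : ℕ} (hn : 0 < n) {z : Fin d → ℤ} {B : Set (Fin d → ℤ)}
    (hrec : Reconstructing n z B) : B.Finite := by
  have : NeZero n := ⟨hn.ne'⟩
  refine Set.Finite.of_injOn (f := fun h => ((h ⬝ᵥ z : ℤ) : ZMod n)) (t := Set.univ)
    (fun _ _ => Set.mem_univ _) (fun h hh h' hh' e => ?_) Set.finite_univ
  by_contra hne
  exact hrec h hh h' hh' hne ((ZMod.intCast_eq_intCast_iff _ _ _).1 e)

instance isProbabilityMeasure_torusMeasure (d : ℕ) : IsProbabilityMeasure (torusMeasure d) := by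
  unfold torusMeasure
  infer_instance

theorem orthonormal_toLp_mFourier (d : ℕ) : Orthonormal ℂ fun h : Fin d → ℤ =>
    ContinuousMap.toLp (E := ℂ) 2 (torusMeasure d) ℂ (mFourier h) :=
  orthonormal_mFourier

/-- Parseval's identity for the sum of an absolutely convergent Fourier series. -/
theorem eLpNorm_two_sq_eq_tsum {a : (Fin d → ℤ) → ℂ} (ha : Summable fun h => ‖a h‖)
    {F : UnitAddTorus (Fin d) → ℂ} (hF : ∀ x, HasSum (fun h => a h * mFourier h x) (F x)) :
    eLpNorm F 2 (torusMeasure d) ^ 2 = ∑' h, ENNReal.ofReal (‖a h‖ ^ 2) := by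
  have hsum : Summable fun h => a h • (mFourier h : C(UnitAddTorus (Fin d), ℂ)) :=
    Summable.of_norm (by simpa only [norm_smul, mFourier_norm, mul_one] using ha)
  obtain ⟨G, hG⟩ := hsum
  have hFG : F = G := by
    ext x
    refine (hF x).unique ?_
    simpa using ContinuousMap.hasSum_apply hG x
  set μ := torusMeasure d
  have hL : HasSum (fun h => a h • ContinuousMap.toLp (E := ℂ) 2 μ ℂ (mFourier h))
      (ContinuousMap.toLp (E := ℂ) 2 μ ℂ G) := by
    simpa using hG.mapL (ContinuousMap.toLp (E := ℂ) 2 μ ℂ)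
  have hsq : HasSum (fun h => ‖a h‖ ^ 2) (‖ContinuousMap.toLp (E := ℂ) 2 μ ℂ G‖ ^ 2) := by
    have h1 := (hL.norm.pow 2 : Tendsto _ _ _)
    refine Tendsto.congr (fun s => ?_) h1
    have h2 := (orthonormal_toLp_mFourier d).inner_sum a a s
    rw [inner_self_eq_norm_sq_to_K] at h2
    simp_rw [Complex.conj_mul'] at h2
    refine Complex.ofReal_injective ?_
    rw [Complex.ofReal_pow, Complex.ofReal_sum]
    simp_rw [Complex.ofReal_pow]
    exact h2
  have hnorm : eLpNorm F 2 μ = ENNReal.ofReal ‖ContinuousMap.toLp (E := ℂ) 2 μ ℂ G‖ := by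
    rw [ofReal_norm, Lp.enorm_def, hFG]
    exact eLpNorm_congr_ae (ContinuousMap.coeFn_toLp μ G).symm
  rw [hnorm, ← ENNReal.ofReal_pow (norm_nonneg _), ← hsq.tsum_eq,
    ENNReal.ofReal_tsum_of_nonneg (fun _ => sq_nonneg _) hsq.summable]

end Exponentials

/-! ### Least squares -/

section LeastSquares

theorem sq_norm_sub_eq_add_of_mem {W : Type*} [NormedAddCommGroup W] [InnerProductSpace ℂ W]
    (K : Submodule ℂ W) [K.HasOrthogonalProjection] {w : W} (hw : w ∈ K) (b : W) :
    ‖w - b‖ ^ 2 = ‖w - K.starProjection b‖ ^ 2 + ‖K.starProjection b - b‖ ^ 2 := by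
  have h : inner ℂ (w - K.starProjection b) (K.starProjection b - b) = 0 := by
    have h1 := K.sub_starProjection_mem_orthogonal b
    rw [← neg_sub b, inner_neg_right, neg_eq_zero]
    exact h1 _ (K.sub_mem hw (K.starProjection_apply_mem b))
  have h2 := norm_add_sq_eq_norm_sq_add_norm_sq_of_inner_eq_zero _ _ h
  rw [sub_add_sub_cancel] at h2
  simpa only [sq] using h2

variable {d n m : ℕ} {B : Set (Fin d → ℤ)} [Fintype B]

/-- The trigonometric polynomial with coefficients `u`. -/
noncomputable def trigPoly (u : EuclideanSpace ℂ B) (x : UnitAddTorus (Fin d)) : ℂ :=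
  ∑ h : B, u h * mFourier h.1 x

theorem mem_trigSpan_iff {g : UnitAddTorus (Fin d) → ℂ} :
    g ∈ trigSpan B ↔ ∃ u : EuclideanSpace ℂ B, trigPoly u = g := by
  rw [trigSpan, Set.image_eq_range, Submodule.mem_span_range_iff_exists_fun]
  have e : ∀ c : B → ℂ, ∑ h : B, c h • ⇑(mFourier h.1) = trigPoly (WithLp.toLp 2 c) := fun c => by
    ext x
    simp [trigPoly]
  constructor
  · rintro ⟨c, rfl⟩
    exact ⟨_, (e c).symm⟩
  · rintro ⟨u, rfl⟩
    exact ⟨u.ofLp, e u.ofLp⟩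

/-- The conjugate of the `k`-th row of the Fourier matrix of the lattice, with columns in `B`, so
that `⟪fourierRow n z k, u⟫` is the value of `trigPoly u` at the `k`-th lattice point. -/
noncomputable def fourierRow (n : ℕ) (z : Fin d → ℤ) (k : Fin n) : EuclideanSpace ℂ B :=
  WithLp.toLp 2 fun h => (starRingEnd ℂ) (mFourier h.1 (latticePoint n z k))

theorem inner_fourierRow (z : Fin d → ℤ) (k : Fin n) (u : EuclideanSpace ℂ B) :
    inner ℂ (fourierRow n z k) u = trigPoly u (latticePoint n z k) := by
  simp [fourierRow, trigPoly, PiLp.inner_apply]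

theorem norm_fourierRow_sq (z : Fin d → ℤ) (k : Fin n) :
    ‖(fourierRow n z k : EuclideanSpace ℂ B)‖ ^ 2 = B.ncard := by
  rw [EuclideanSpace.norm_sq_eq]
  simp [fourierRow, norm_mFourier_apply]

/-- The reconstructing property makes the rows of the Fourier matrix a tight frame. -/
theorem sum_norm_inner_fourierRow_sq (hn : 0 < n) {z : Fin d → ℤ} (hrec : Reconstructing n z B)
    (u : EuclideanSpace ℂ B) :
    ∑ k : Fin n, ‖inner ℂ (fourierRow n z k) u‖ ^ 2 = n * ‖u‖ ^ 2 := by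
  classical
  have key : ((∑ k : Fin n, ‖inner ℂ (fourierRow n z k) u‖ ^ 2 : ℝ) : ℂ) =
      ((n * ‖u‖ ^ 2 : ℝ) : ℂ) := by
    rw [EuclideanSpace.norm_sq_eq]
    push_cast
    calc ∑ k : Fin n, (‖inner ℂ (fourierRow n z k) u‖ : ℂ) ^ 2
        = ∑ k : Fin n, ∑ h : B, ∑ h' : B, u h * (starRingEnd ℂ) (u h') *
            (mFourier h.1 (latticePoint n z k) *
              (starRingEnd ℂ) (mFourier h'.1 (latticePoint n z k))) := by
          refine Finset.sum_congr rfl fun k _ => ?_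
          rw [← Complex.mul_conj', inner_fourierRow, trigPoly, map_sum, Finset.sum_mul_sum]
          refine Finset.sum_congr rfl fun h _ => Finset.sum_congr rfl fun h' _ => ?_
          rw [map_mul]
          ring
      _ = ∑ h : B, ∑ h' : B, u h * (starRingEnd ℂ) (u h') * if h = h' then (n : ℂ) else 0 := by
          rw [Finset.sum_comm]
          refine Finset.sum_congr rfl fun h _ => ?_
          rw [Finset.sum_comm]
          refine Finset.sum_congr rfl fun h' _ => ?_
          rw [← Finset.mul_sum, sum_mFourier_mul_conj hn z hrec]
      _ = n * ∑ h : B, (‖u h‖ : ℂ) ^ 2 := by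
          simp [Complex.mul_conj', Finset.mul_sum, mul_comm]
  exact_mod_cast key

/-- Sampling the trigonometric polynomial with given coefficients at the lattice points indexed
by `j`. -/
noncomputable def sampling (z : Fin d → ℤ) (j : Fin m → Fin n) :
    EuclideanSpace ℂ B →ₗ[ℂ] EuclideanSpace ℂ (Fin m) where
  toFun u := WithLp.toLp 2 fun i => inner ℂ (fourierRow n z (j i)) u
  map_add' u v := by ext i; simp
  map_smul' c u := by ext i; simp

/-- The values of `f` at the lattice points indexed by `j`. -/
noncomputable def sampleValues (z : Fin d → ℤ) (j : Fin m → Fin n)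
    (f : UnitAddTorus (Fin d) → ℂ) : EuclideanSpace ℂ (Fin m) :=
  WithLp.toLp 2 fun i => f (latticePoint n z (j i))

theorem sampleValues_trigPoly (z : Fin d → ℤ) (j : Fin m → Fin n) (u : EuclideanSpace ℂ B) :
    sampleValues z j (trigPoly u) = sampling z j u := by
  ext i
  simp [sampleValues, sampling, inner_fourierRow]

theorem norm_sampling_sq (z : Fin d → ℤ) (j : Fin m → Fin n) (u : EuclideanSpace ℂ B) :
    ‖sampling z j u‖ ^ 2 = ∑ i, ‖inner ℂ (fourierRow n z (j i)) u‖ ^ 2 := by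
  rw [EuclideanSpace.norm_sq_eq]
  rfl

/-- The least squares minimisers are the polynomials whose samples are the orthogonal projection of
the data onto the range of the sampling map. -/
theorem isLeastSquares_iff {z : Fin d → ℤ} {j : Fin m → Fin n}
    {f g : UnitAddTorus (Fin d) → ℂ} :
    IsLeastSquares z B j f g ↔ ∃ u : EuclideanSpace ℂ B, trigPoly u = g ∧
      sampling z j u = (sampling z j : EuclideanSpace ℂ B →ₗ[ℂ] _).range.starProjection
        (sampleValues z j f) := by
  set K := (sampling z j : EuclideanSpace ℂ B →ₗ[ℂ] _).range with hK
  set b := sampleValues z j f with hb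
  have hobj : ∀ u : EuclideanSpace ℂ B,
      ∑ i, ‖trigPoly u (latticePoint n z (j i)) - f (latticePoint n z (j i))‖ ^ 2 =
        ‖sampling z j u - K.starProjection b‖ ^ 2 + ‖K.starProjection b - b‖ ^ 2 := fun u => by
    rw [← sq_norm_sub_eq_add_of_mem K (hK ▸ LinearMap.mem_range_self _ u), ← sampleValues_trigPoly, EuclideanSpace.norm_sq_eq]
    rfl
  obtain ⟨u₀, hu₀⟩ : ∃ u₀ : EuclideanSpace ℂ B, sampling z j u₀ = K.starProjection b := K.starProjection_apply_mem b
  rw [IsLeastSquares, mem_trigSpan_iff]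
  constructor
  · rintro ⟨⟨u, rfl⟩, hmin⟩
    refine ⟨u, rfl, ?_⟩
    have h := isMinOn_iff.1 hmin _ (mem_trigSpan_iff.2 ⟨u₀, rfl⟩)
    rw [hobj, hobj, hu₀, sub_self, norm_zero] at h
    have h0 : ‖sampling z j u - K.starProjection b‖ ^ 2 ≤ 0 := by linarith
    have h1 := pow_eq_zero_iff two_ne_zero |>.1 (le_antisymm h0 (sq_nonneg _))
    exact sub_eq_zero.1 (norm_eq_zero.1 h1)
  · rintro ⟨u, rfl, hu⟩
    refine ⟨⟨u, rfl⟩, isMinOn_iff.2 fun g hg => ?_⟩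
    obtain ⟨w, rfl⟩ := mem_trigSpan_iff.1 hg
    rw [hobj, hobj, hu, sub_self, norm_zero]
    nlinarith [sq_nonneg ‖sampling z j w - K.starProjection b‖]

theorem sampling_injective {z : Fin d → ℤ} {j : Fin m → Fin n} {c : ℝ} (hc : 0 < c)
    (hlow : ∀ u : EuclideanSpace ℂ B, c * ‖u‖ ^ 2 ≤ ‖sampling z j u‖ ^ 2) :
    Function.Injective (sampling z j : EuclideanSpace ℂ B →ₗ[ℂ] _) := by
  rw [← LinearMap.ker_eq_bot, LinearMap.ker_eq_bot']
  intro u hu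
  have h := hlow u
  rw [hu, norm_zero] at h
  by_contra hne
  have := norm_pos_iff.2 hne
  have : 0 < c * ‖u‖ ^ 2 := by positivity
  linarith

theorem existsUnique_isLeastSquares {z : Fin d → ℤ} {j : Fin m → Fin n}
    (hinj : Function.Injective (sampling z j : EuclideanSpace ℂ B →ₗ[ℂ] _))
    (f : UnitAddTorus (Fin d) → ℂ) : ∃! g, IsLeastSquares z B j f g := by
  obtain ⟨u, hu⟩ : ∃ u : EuclideanSpace ℂ B, sampling z j u =
      (sampling z j : EuclideanSpace ℂ B →ₗ[ℂ] _).range.starProjection (sampleValues z j f) :=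
    LinearMap.mem_range.1 (Submodule.starProjection_apply_mem _ _)
  refine ⟨trigPoly u, isLeastSquares_iff.2 ⟨u, rfl, hu⟩, fun g hg => ?_⟩
  obtain ⟨w, rfl, hw⟩ := isLeastSquares_iff.1 hg
  rw [hinj (hw.trans hu.symm)]

/-- Stability of least squares: compared with any `u₁`, the error of the coefficients of the least
squares approximation is controlled by the residual of `u₁` at the sampling points. -/
theorem exists_leastSquares_eq_trigPoly {z : Fin d → ℤ} {j : Fin m → Fin n} {c : ℝ} (hc : 0 < c)
    (hlow : ∀ u : EuclideanSpace ℂ B, c * ‖u‖ ^ 2 ≤ ‖sampling z j u‖ ^ 2)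
    (f : UnitAddTorus (Fin d) → ℂ) (u₁ : EuclideanSpace ℂ B) :
    ∃ u : EuclideanSpace ℂ B, leastSquares z B j f = trigPoly u ∧
      c * ‖u - u₁‖ ^ 2 ≤ ‖sampleValues z j f - sampling z j u₁‖ ^ 2 := by
  have hls : IsLeastSquares z B j f (leastSquares z B j f) :=
    Classical.epsilon_spec (existsUnique_isLeastSquares (sampling_injective hc hlow) f).exists
  obtain ⟨u, hu, hproj⟩ := isLeastSquares_iff.1 hls
  refine ⟨u, hu.symm, (hlow _).trans ?_⟩
  have h := sq_norm_sub_eq_add_of_mem _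
    (LinearMap.mem_range_self (sampling z j : EuclideanSpace ℂ B →ₗ[ℂ] _) u₁) (sampleValues z j f)
  rw [map_sub, hproj, norm_sub_rev, norm_sub_rev (sampleValues z j f), h]
  exact le_add_of_nonneg_right (sq_nonneg _)

end LeastSquares

/-! ### The rows of the matrix `Φ_B` -/

section PhiRows

variable {d n : ℕ} {r : (Fin d → ℤ) → ℝ} {z : Fin d → ℤ} {B : Set (Fin d → ℤ)}

theorem norm_phiMatrix_sq (hr : ∀ h, 0 < r h) (k : Fin n) (h : ↥Bᶜ) :
    ‖phiMatrix r n z B k h‖ ^ 2 = 1 / r h := by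
  rw [phiMatrix, Matrix.of_apply, ← mFourier_latticePoint, norm_div, norm_mFourier_apply,
    Complex.norm_real, Real.norm_eq_abs, div_pow, sq_abs, Real.sq_sqrt (hr h).le, one_pow]

/-- The conjugate of the `k`-th row of `Φ_B`, as an element of `ℓ²`. -/
noncomputable def phiRow (hr : ∀ h, 0 < r h) (hsum : Summable fun h : ↥Bᶜ => 1 / r h) (n : ℕ)
    (z : Fin d → ℤ) (k : Fin n) : lp (fun _ : ↥Bᶜ => ℂ) 2 :=
  ⟨fun h => (starRingEnd ℂ) (phiMatrix r n z B k h), memℓp_gen (by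
    simpa [norm_phiMatrix_sq hr] using hsum)⟩

theorem hasSum_inner_phiRow (hr : ∀ h, 0 < r h) (hsum : Summable fun h : ↥Bᶜ => 1 / r h)
    (k : Fin n) (x : lp (fun _ : ↥Bᶜ => ℂ) 2) :
    HasSum (fun h => phiMatrix r n z B k h * x h) (inner ℂ (phiRow hr hsum n z k) x) := by
  simpa [phiRow, mul_comm] using lp.hasSum_inner (𝕜 := ℂ) (phiRow hr hsum n z k) x

theorem norm_phiRow_sq (hr : ∀ h, 0 < r h) (hsum : Summable fun h : ↥Bᶜ => 1 / r h) (k : Fin n) :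
    ‖phiRow hr hsum n z k‖ ^ 2 = ∑' h : ↥Bᶜ, 1 / r h := by
  have h := lp.norm_rpow_eq_tsum (p := 2) (by norm_num) (phiRow hr hsum n z k)
  simpa [phiRow, norm_phiMatrix_sq hr] using h

/-- The defining inequality of the spectral norm, for a finitely supported vector. -/
theorem sum_norm_mulVec_sq_le {κ ι : Type*} [Fintype κ] (M : Matrix κ ι ℂ) (hM : specNorm M ≠ ∞)
    (s : Finset ι) (x : ι → ℂ) :
    ∑ k, ‖∑ j ∈ s, M k j * x j‖ ^ 2 ≤ (specNorm M).toReal ^ 2 * ∑ j ∈ s, ‖x j‖ ^ 2 := by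
  classical
  set q := ∑ j ∈ s, ‖x j‖ ^ 2 with hq
  have hq0 : 0 ≤ q := Finset.sum_nonneg fun _ _ => sq_nonneg _
  rcases hq0.eq_or_lt with h0 | hpos
  · have hx : ∀ j ∈ s, x j = 0 := fun j hj => by
      have := (Finset.sum_eq_zero_iff_of_nonneg fun _ _ => sq_nonneg _).1 h0.symm j hj
      simpa using this
    have : ∀ k, ∑ j ∈ s, M k j * x j = 0 := fun k =>
      Finset.sum_eq_zero fun j hj => by rw [hx j hj, mul_zero]
    simp [this, ← h0]
  · set y : ι →₀ ℂ := Finsupp.onFinset s (fun j => if j ∈ s then ((√q)⁻¹ : ℂ) * x j else 0)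
      (fun j hj => by by_contra h; simp [h] at hj) with hy
    have hysub : y.support ⊆ s := Finsupp.support_onFinset_subset
    have hyval : ∀ j ∈ s, y j = ((√q)⁻¹ : ℂ) * x j := fun j hj => by simp [hy, hj]
    have hsq : 0 < √q := Real.sqrt_pos.2 hpos
    have hnorm : ‖((√q)⁻¹ : ℂ)‖ ^ 2 = q⁻¹ := by
      rw [norm_inv, Complex.norm_real, Real.norm_eq_abs, inv_pow, sq_abs, Real.sq_sqrt hq0]
    have h1 : ∑ j ∈ y.support, ‖y j‖ ^ 2 ≤ 1 := by
      rw [Finset.sum_subset hysub fun j _ hj => by rw [Finsupp.notMem_support_iff.1 hj]; simp,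
        Finset.sum_congr rfl fun j hj => by rw [hyval j hj, norm_mul, mul_pow, hnorm],
        ← Finset.mul_sum, ← hq, inv_mul_cancel₀ hpos.ne']
    have h2 : ∀ k, ‖∑ j ∈ y.support, M k j * y j‖ ^ 2 = q⁻¹ * ‖∑ j ∈ s, M k j * x j‖ ^ 2 := by
      intro k
      rw [Finset.sum_subset hysub fun j _ hj => by rw [Finsupp.notMem_support_iff.1 hj, mul_zero],
        Finset.sum_congr rfl fun j hj => by rw [hyval j hj, mul_left_comm],
        ← Finset.mul_sum, norm_mul, mul_pow, hnorm]
    have h3 : ENNReal.ofReal √(∑ k, ‖∑ j ∈ y.support, M k j * y j‖ ^ 2) ≤ specNorm M :=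
      le_iSup₂ (f := fun (x : ι →₀ ℂ) (_ : ∑ j ∈ x.support, ‖x j‖ ^ 2 ≤ 1) =>
        ENNReal.ofReal √(∑ k, ‖∑ j ∈ x.support, M k j * x j‖ ^ 2)) y h1
    rw [ENNReal.ofReal_le_iff_le_toReal hM, Real.sqrt_le_left ENNReal.toReal_nonneg] at h3
    simp_rw [h2] at h3
    rw [← Finset.mul_sum, inv_mul_le_iff₀ hpos] at h3
    rwa [mul_comm] at h3

/-- The spectral norm bound extends from finitely supported vectors to `ℓ²` by a limit. -/
theorem sum_norm_inner_phiRow_sq_le (hr : ∀ h, 0 < r h)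
    (hsum : Summable fun h : ↥Bᶜ => 1 / r h) (hM : specNorm (phiMatrix r n z B) ≠ ∞)
    (x : lp (fun _ : ↥Bᶜ => ℂ) 2) :
    ∑ k : Fin n, ‖inner ℂ (phiRow hr hsum n z k) x‖ ^ 2 ≤
      (specNorm (phiMatrix r n z B)).toReal ^ 2 * ‖x‖ ^ 2 := by
  have hx : HasSum (fun h => ‖x h‖ ^ 2) (‖x‖ ^ 2) := by
    simpa using lp.hasSum_norm (p := 2) (by norm_num) x
  refine le_of_tendsto_of_tendsto' (tendsto_finsetSum _ fun k _ =>
    ((hasSum_inner_phiRow hr hsum k x).norm.pow 2 : Tendsto _ _ _))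
    ((hx.mul_left _ : Tendsto _ _ _)) fun s => ?_
  rw [← Finset.mul_sum]
  exact sum_norm_mulVec_sq_le _ hM s x

end PhiRows

/-! ### The worst-case error -/

section WorstCase

variable {d n m : ℕ} {r : (Fin d → ℤ) → ℝ} {z : Fin d → ℤ} {B : Set (Fin d → ℤ)}

theorem tsum_ofReal_mul_norm_fourierCoef_sq_le {f : UnitAddTorus (Fin d) → ℂ}
    (hf : hNorm r f ≤ 1) :
    ∑' h, ENNReal.ofReal (r h * ‖fourierCoef f h‖ ^ 2) ≤ 1 := by
  rw [hNorm] at hf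
  have := ENNReal.rpow_le_rpow hf (z := 2) (by norm_num)
  rwa [← ENNReal.rpow_mul, one_div, inv_mul_cancel₀ two_ne_zero, ENNReal.rpow_one,
    ENNReal.one_rpow] at this

theorem summable_norm_fourierCoef {f : UnitAddTorus (Fin d) → ℂ} (hf : MemH r f) :
    Summable fun h => ‖fourierCoef f h‖ := by
  have := (hf.2.1 0).summable.norm
  simpa [norm_mFourier_apply] using this

/-- Splitting the `L²` error of a trigonometric polynomial approximation into its parts with
frequencies inside and outside `B`. -/
theorem eLpNorm_sub_trigPoly_sq [Fintype B] {f : UnitAddTorus (Fin d) → ℂ} (hf : MemH r f)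
    (u : EuclideanSpace ℂ B) :
    eLpNorm (f - trigPoly u) 2 (torusMeasure d) ^ 2 =
      ENNReal.ofReal (‖u - WithLp.toLp 2 fun h : B => fourierCoef f h‖ ^ 2) +
        ∑' h : ↥Bᶜ, ENNReal.ofReal (‖fourierCoef f h‖ ^ 2) := by
  classical
  let w : (Fin d → ℤ) → ℂ := fun h => if hh : h ∈ B then u ⟨h, hh⟩ else 0
  have hwB : ∀ h : B, w h = u h := fun h => by simp [w]
  have hwB' : ∀ h : ↥Bᶜ, w h = 0 := fun h => dif_neg h.2
  have hw : ∀ h ∉ B.toFinset, w h = 0 := fun h hh => dif_neg (by simpa using hh)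
  have hsumw : ∀ x, HasSum (fun h => w h * mFourier h x) (trigPoly u x) := fun x => by
    have h1 : trigPoly u x = ∑ h ∈ B.toFinset, w h * mFourier h x := by
      rw [trigPoly, Finset.sum_subtype B.toFinset (p := (· ∈ B)) fun h => Set.mem_toFinset]
      exact Finset.sum_congr rfl fun h _ => by rw [← hwB]
    rw [h1]
    exact hasSum_sum_of_ne_finset_zero fun h hh => by rw [hw h hh, zero_mul]
  have hF : ∀ x, HasSum (fun h => (fourierCoef f h - w h) * mFourier h x)
      ((f - trigPoly u) x) := fun x => by
    simp only [sub_mul]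
    exact (hf.2.1 x).sub (hsumw x)
  have habs : Summable fun h => ‖fourierCoef f h - w h‖ :=
    .of_nonneg_of_le (fun _ => norm_nonneg _) (fun _ => norm_sub_le _ _)
      ((summable_norm_fourierCoef hf).add
        (summable_of_ne_finset_zero (s := B.toFinset) fun h hh => by rw [hw h hh, norm_zero]))
  rw [eLpNorm_two_sq_eq_tsum habs hF, ← ENNReal.summable.tsum_add_tsum_compl (s := B)
    ENNReal.summable, tsum_fintype, EuclideanSpace.norm_sq_eq,
    ENNReal.ofReal_sum_of_nonneg fun _ _ => sq_nonneg _]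
  congr 1
  · refine Finset.sum_congr rfl fun h _ => ?_
    rw [hwB, norm_sub_rev]
    rfl
  · exact tsum_congr fun h => by rw [hwB', sub_zero]

theorem tsum_norm_fourierCoef_compl_sq_le (hr : ∀ h, 0 < r h) {f : UnitAddTorus (Fin d) → ℂ}
    (hf : hNorm r f ≤ 1) :
    ∑' h : ↥Bᶜ, ENNReal.ofReal (‖fourierCoef f h‖ ^ 2) ≤
      ⨆ h : ↥Bᶜ, ENNReal.ofReal (1 / r h) := by
  calc ∑' h : ↥Bᶜ, ENNReal.ofReal (‖fourierCoef f h‖ ^ 2)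
      ≤ ∑' h : ↥Bᶜ, (⨆ h : ↥Bᶜ, ENNReal.ofReal (1 / r h)) *
          ENNReal.ofReal (r h * ‖fourierCoef f h‖ ^ 2) := by
        refine ENNReal.tsum_le_tsum fun h => ?_
        have : ‖fourierCoef f h‖ ^ 2 = 1 / r h * (r h * ‖fourierCoef f h‖ ^ 2) := by
          have := (hr h).ne'
          field_simp
        refine (congrArg ENNReal.ofReal this).trans_le ?_
        rw [ENNReal.ofReal_mul (one_div_nonneg.2 (hr h).le)]
        exact mul_le_mul_left (le_iSup (fun h : ↥Bᶜ => ENNReal.ofReal (1 / r h)) h) _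
    _ ≤ (⨆ h : ↥Bᶜ, ENNReal.ofReal (1 / r h)) * 1 := by
        rw [ENNReal.tsum_mul_left]
        gcongr
        exact (ENNReal.tsum_comp_le_tsum_of_injective Subtype.val_injective _).trans
          (tsum_ofReal_mul_norm_fourierCoef_sq_le hf)
    _ = _ := mul_one _

/-- The part of `f` with frequencies outside `B`, evaluated at lattice points, is the image under
`Φ_B` of a vector in the unit ball of `ℓ²`. -/
theorem exists_unit_vector_inner_phiRow [Fintype B] (hr : ∀ h, 0 < r h)
    (hsum : Summable fun h : ↥Bᶜ => 1 / r h) {f : UnitAddTorus (Fin d) → ℂ} (hf : MemH r f)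
    (hf1 : hNorm r f ≤ 1) :
    ∃ c : lp (fun _ : ↥Bᶜ => ℂ) 2, ‖c‖ ^ 2 ≤ 1 ∧ ∀ k : Fin n,
      f (latticePoint n z k) -
          trigPoly (WithLp.toLp 2 fun h : B => fourierCoef f h) (latticePoint n z k) =
        inner ℂ (phiRow hr hsum n z k) c := by
  have hle : ∑' h : ↥Bᶜ, ENNReal.ofReal (r h * ‖fourierCoef f h‖ ^ 2) ≤ 1 :=
    (ENNReal.tsum_comp_le_tsum_of_injective Subtype.val_injective _).trans
      (tsum_ofReal_mul_norm_fourierCoef_sq_le hf1)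
  have hnn : ∀ h : ↥Bᶜ, 0 ≤ r h * ‖fourierCoef f h‖ ^ 2 := fun h =>
    mul_nonneg (hr h).le (sq_nonneg _)
  have hsummable : Summable fun h : ↥Bᶜ => r h * ‖fourierCoef f h‖ ^ 2 := by
    have := ENNReal.summable_toReal (hle.trans_lt ENNReal.one_lt_top).ne
    simpa only [ENNReal.toReal_ofReal (hnn _)] using this
  have hnorm : ∀ h : ↥Bᶜ, ‖(√(r h) : ℂ) * fourierCoef f h‖ ^ 2 = r h * ‖fourierCoef f h‖ ^ 2 :=
    fun h => by
      rw [norm_mul, mul_pow, Complex.norm_real, Real.norm_eq_abs, sq_abs, Real.sq_sqrt (hr h).le]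
  let c : lp (fun _ : ↥Bᶜ => ℂ) 2 := ⟨fun h => (√(r h) : ℂ) * fourierCoef f h, memℓp_gen (by
    simpa only [ENNReal.toReal_ofNat, Real.rpow_ofNat, hnorm] using hsummable)⟩
  refine ⟨c, ?_, fun k => ?_⟩
  · have h1 := lp.norm_rpow_eq_tsum (p := 2) (by norm_num) c
    simp only [ENNReal.toReal_ofNat, Real.rpow_ofNat] at h1
    rw [h1]
    have h2 : ∑' h, ‖c h‖ ^ 2 = ∑' h : ↥Bᶜ, r h * ‖fourierCoef f h‖ ^ 2 :=
      tsum_congr fun h => hnorm h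
    rw [h2, ← ENNReal.ofReal_le_one, ENNReal.ofReal_tsum_of_nonneg hnn hsummable]
    exact hle
  · have h1 := (hf.2.1 (latticePoint n z k))
    have h2 : HasSum ((fun h => fourierCoef f h * mFourier h (latticePoint n z k)) ∘
        ((↑) : ↥Bᶜ → _)) (inner ℂ (phiRow hr hsum n z k) c) := by
      convert hasSum_inner_phiRow hr hsum k c using 2 with h
      have : (√(r h) : ℂ) ≠ 0 := Complex.ofReal_ne_zero.2 (Real.sqrt_pos.2 (hr h)).ne'
      change fourierCoef f h * mFourier h.1 (latticePoint n z k) =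
        phiMatrix r n z B k h * ((√(r h) : ℂ) * fourierCoef f h)
      rw [phiMatrix, Matrix.of_apply, ← mFourier_latticePoint]
      field_simp
    have h3 : HasSum ((fun h => fourierCoef f h * mFourier h (latticePoint n z k)) ∘
        ((↑) : B → _))
        (trigPoly (WithLp.toLp 2 fun h : B => fourierCoef f h) (latticePoint n z k)) :=
      hasSum_fintype _
    rw [sub_eq_iff_eq_add', h1.unique (h3.add_compl h2)]

/-- The deterministic error bound, given the two spectral bounds for the sampled matrices. -/
theorem worstCaseError_sq_le [Fintype B] (hr : ∀ h, 0 < r h)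
    (hsum : Summable fun h : ↥Bᶜ => 1 / r h) {j : Fin m → Fin n} {c θ : ℝ} (hc : 0 < c)
    (hlow : ∀ u : EuclideanSpace ℂ B, c * ‖u‖ ^ 2 ≤ ‖sampling z j u‖ ^ 2) (hθ : 0 ≤ θ)
    (hup : ∀ x, ∑ i, ‖inner ℂ (phiRow (B := B) hr hsum n z (j i)) x‖ ^ 2 ≤ θ * ‖x‖ ^ 2) :
    worstCaseError r (leastSquares z B j) ^ 2 ≤
      (⨆ h : ↥Bᶜ, ENNReal.ofReal (1 / r h)) + ENNReal.ofReal (θ / c) := by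
  suffices h : worstCaseError r (leastSquares z B j) ≤
      ((⨆ h : ↥Bᶜ, ENNReal.ofReal (1 / r h)) + ENNReal.ofReal (θ / c)) ^ (2 : ℝ)⁻¹ by
    simpa using (ENNReal.le_rpow_inv_iff (by norm_num)).1 h
  refine iSup₂_le fun f hf => ?_
  rw [ENNReal.le_rpow_inv_iff (by norm_num), ENNReal.rpow_ofNat]
  obtain ⟨x, hx1, hx⟩ := exists_unit_vector_inner_phiRow (z := z) (n := n) hr hsum hf.1 hf.2
  set u₁ : EuclideanSpace ℂ B := WithLp.toLp 2 fun h : B => fourierCoef f h with hu₁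
  obtain ⟨u, hu, hstab⟩ := exists_leastSquares_eq_trigPoly hc hlow f u₁
  rw [hu, eLpNorm_sub_trigPoly_sq hf.1, add_comm]
  refine add_le_add (tsum_norm_fourierCoef_compl_sq_le hr hf.2) (ENNReal.ofReal_le_ofReal ?_)
  rw [le_div_iff₀ hc, mul_comm]
  refine hstab.trans ?_
  have h1 : ‖sampleValues z j f - sampling z j u₁‖ ^ 2 =
      ∑ i, ‖inner ℂ (phiRow (B := B) hr hsum n z (j i)) x‖ ^ 2 := by
    rw [← sampleValues_trigPoly, EuclideanSpace.norm_sq_eq]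
    refine Finset.sum_congr rfl fun i _ => ?_
    rw [← hx]
    rfl
  rw [h1]
  exact (hup x).trans (mul_le_of_le_one_right hθ hx1)

end WorstCase

/-! ### The random sample -/

section RandomSample

open Classical in
/-- Two bad events of probability at most `exp (-t)` each cover the complement of `p`. -/
theorem one_sub_three_mul_exp_lt_measureReal {n m : ℕ} (hn : 0 < n) {Ω : Type*}
    [MeasurableSpace Ω] (P : Measure Ω) [IsProbabilityMeasure P] (J : Fin m → Ω → Fin n)
    (hlaw : ∀ i, HasLaw (J i) (uniformOn Set.univ) P) (hindep : iIndepFun J P) (t : ℝ)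
    {p q₁ q₂ : (Fin m → Fin n) → Prop}
    (h₁ : (Finset.univ.filter q₁).card ≤ Real.exp (-t) * (n : ℝ) ^ m)
    (h₂ : (Finset.univ.filter q₂).card ≤ Real.exp (-t) * (n : ℝ) ^ m)
    (hp : ∀ j, ¬ q₁ j → ¬ q₂ j → p j) :
    1 - 3 * Real.exp (-t) < P.real {ω | p fun i => J i ω} := by
  have hN : (0 : ℝ) < (n : ℝ) ^ m := pow_pos (Nat.cast_pos.2 hn) m
  rw [measureReal_setOf_comp hn P J hlaw hindep, lt_div_iff₀ hN]
  have hcover : (Finset.univ : Finset (Fin m → Fin n)) ⊆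
      Finset.univ.filter p ∪ (Finset.univ.filter q₁ ∪ Finset.univ.filter q₂) := fun j _ => by
    have := hp j
    simp only [Finset.mem_union, Finset.mem_filter, Finset.mem_univ, true_and]
    tauto
  have hcard := ((Finset.card_le_card hcover).trans (Finset.card_union_le _ _)).trans
    (Nat.add_le_add_left (Finset.card_union_le _ _) _)
  rw [Finset.card_univ, Fintype.card_pi_const, Fintype.card_fin] at hcard
  have hcard' : (n : ℝ) ^ m ≤ (Finset.univ.filter p).card +
      ((Finset.univ.filter q₁).card + (Finset.univ.filter q₂).card) := by exact_mod_cast hcard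
  have := mul_pos (Real.exp_pos (-t)) hN
  linarith

open Classical in
/-- Outside an event `q` of probability at most `exp (-t)`, the lower spectral bound for the sampled
Fourier matrix implies the bound for the worst-case error. -/
theorem exists_rare_event_error_bound {d : ℕ} {r : (Fin d → ℤ) → ℝ} (hr : ∀ h, 0 < r h) {n : ℕ}
    (hn : 0 < n) {z : Fin d → ℤ} {B : Set (Fin d → ℤ)} [Fintype B] {t : ℝ} (ht : 1 ≤ t) {m : ℕ}
    (hm : 0 < m) :
    ∃ q : (Fin m → Fin n) → Prop,
      (Finset.univ.filter q).card ≤ Real.exp (-t) * (n : ℝ) ^ m ∧ ∀ j, ¬ q j →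
        (∀ u : EuclideanSpace ℂ B, (m / 3 : ℝ) * ‖u‖ ^ 2 ≤ ‖sampling z j u‖ ^ 2) →
        worstCaseError r (leastSquares z B j) ^ 2 ≤
          (⨆ h : ↥Bᶜ, ENNReal.ofReal (1 / r h)) +
          ENNReal.ofReal (42 * (Real.log m + t) / m) * (∑' h : ↥Bᶜ, ENNReal.ofReal (1 / r h)) +
          ENNReal.ofReal (4 / n) * specNorm (phiMatrix r n z B) ^ 2 := by
  have hmpos : (0 : ℝ) < m := Nat.cast_pos.2 hm
  have hnpos : (0 : ℝ) < n := Nat.cast_pos.2 hn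
  have hlog : 0 ≤ Real.log m := Real.log_natCast_nonneg m
  have hcoef : 0 < 42 * (Real.log m + t) / m := by positivity
  -- If one of the two quantities on the right is infinite, so is the whole bound.
  by_cases htop : ∑' h : ↥Bᶜ, ENNReal.ofReal (1 / r h) = ∞ ∨ specNorm (phiMatrix r n z B) = ∞
  · refine ⟨fun _ => False, by simp; positivity, fun j _ _ => le_top.trans_eq (Eq.symm ?_)⟩
    rcases htop with h | h
    · rw [h, ENNReal.mul_top (ENNReal.ofReal_pos.2 hcoef).ne', add_top, top_add]
    · rw [h, ENNReal.top_pow two_ne_zero,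
        ENNReal.mul_top (ENNReal.ofReal_pos.2 (by positivity)).ne', add_top]
  · obtain ⟨hT, hS⟩ := not_or.1 htop
    have hpos : ∀ h : ↥Bᶜ, 0 ≤ 1 / r h := fun h => one_div_nonneg.2 (hr h).le
    have hsum : Summable fun h : ↥Bᶜ => 1 / r h := by
      simpa only [ENNReal.toReal_ofReal (hpos _)] using ENNReal.summable_toReal hT
    set T := ∑' h : ↥Bᶜ, 1 / r h with hTdef
    set S := (specNorm (phiMatrix r n z B)).toReal with hSdef
    have hT0 : 0 ≤ T := tsum_nonneg hpos
    have hne : Nonempty (Fin n) := ⟨⟨0, hn⟩⟩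
    have htail := card_exists_lt_le (φ := phiRow (B := B) hr hsum n z)
      (fun k => norm_phiRow_sq hr hsum k) (Λ := S ^ 2 / n) (by positivity) (fun x => by
        rw [Fintype.card_fin, mul_div_cancel₀ _ hnpos.ne']
        exact sum_norm_inner_phiRow_sq_le hr hsum hS x) hm ht
    rw [Fintype.card_fin] at htail
    refine ⟨_, htail, fun j hj hlow => ?_⟩
    simp only [not_exists, not_lt] at hj
    refine (worstCaseError_sq_le hr hsum (by positivity) hlow (by positivity) hj).trans_eq ?_
    have hval : (14 * (Real.log m + t) * T + 4 / 3 * (S ^ 2 / n) * m) / (m / 3) =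
        42 * (Real.log m + t) / m * T + 4 / n * S ^ 2 := by
      field_simp
      ring
    rw [hval, ENNReal.ofReal_add (by positivity) (by positivity), ENNReal.ofReal_mul hcoef.le,
      ENNReal.ofReal_mul (by positivity), hTdef, ENNReal.ofReal_tsum_of_nonneg hpos hsum,
      ENNReal.ofReal_pow ENNReal.toReal_nonneg, ENNReal.ofReal_toReal hS, ← add_assoc]

end RandomSample

end LatticeLS

theorem theorem4p4 {d : ℕ} (r : (Fin d → ℤ) → ℝ) (hr : ∀ h, 0 < r h)
    (hr_lim : Tendsto r cofinite atTop)
    (n : ℕ) (hn : 0 < n) (z : Fin d → ℤ)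
    (B : Set (Fin d → ℤ)) (hB : B.Nonempty) (hrec : LatticeLS.Reconstructing n z B)
    (t : ℝ) (ht : 4 ≤ t)
    (m : ℕ) (hm : m = ⌈12 * (B.ncard : ℝ) * (Real.log B.ncard + t)⌉₊)
    {Ω : Type*} [MeasurableSpace Ω] (P : Measure Ω) [IsProbabilityMeasure P]
    (J : Fin m → Ω → Fin n) (hJ_law : ∀ i, HasLaw (J i) (uniformOn Set.univ) P)
    (hJ_indep : iIndepFun J P) :
    1 - 3 * Real.exp (-t) <
      P.real {ω |
        (∀ f : UnitAddTorus (Fin d) → ℂ,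
          ∃! g, LatticeLS.IsLeastSquares z B (fun i => J i ω) f g) ∧
        LatticeLS.worstCaseError r (LatticeLS.leastSquares z B (fun i => J i ω)) ^ 2 ≤
          (⨆ h : ↥Bᶜ, ENNReal.ofReal (1 / r h)) +
          ENNReal.ofReal (42 * (Real.log m + t) / m) *
            (∑' h : ↥Bᶜ, ENNReal.ofReal (1 / r h)) +
          ENNReal.ofReal (4 / n) * LatticeLS.specNorm (LatticeLS.phiMatrix r n z B) ^ 2} ∧
    6 * (Real.log m + t) / m ≤ 1 / (B.ncard : ℝ) ∧
    1 / (B.ncard : ℝ) ≤ 13 * (Real.log m + t) / m := by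
  have hfin : B.Finite := hrec.finite hn
  have : Fintype B := hfin.fintype
  have hD : 0 < B.ncard := (Set.ncard_pos hfin).2 hB
  refine ⟨?_, LatticeLS.sample_size_bounds hD ht hm⟩
  have hlogD : 0 ≤ Real.log B.ncard := Real.log_natCast_nonneg _
  have hmle : 12 * (B.ncard : ℝ) * (Real.log B.ncard + t) ≤ m := hm ▸ Nat.le_ceil _
  have hm0 : 0 < m := by
    rw [hm, Nat.ceil_pos]
    positivity
  have hne : Nonempty (Fin n) := ⟨⟨0, hn⟩⟩
  have hlow := LatticeLS.card_exists_sum_lt_le (F := EuclideanSpace ℂ B)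
    (φ := LatticeLS.fourierRow n z) (D := B.ncard) (by simp) hD
    (LatticeLS.norm_fourierRow_sq z)
    (fun u => by
      rw [Fintype.card_fin]
      exact LatticeLS.sum_norm_inner_fourierRow_sq hn hrec u)
    (by linarith) hmle
  rw [Fintype.card_fin] at hlow
  obtain ⟨q, hq, herr⟩ := LatticeLS.exists_rare_event_error_bound (r := r) hr hn (z := z) (B := B)
    (by linarith : 1 ≤ t) hm0
  refine LatticeLS.one_sub_three_mul_exp_lt_measureReal hn P J hJ_law hJ_indep t hlow hq
    (p := fun j => (∀ f, ∃! g, LatticeLS.IsLeastSquares z B j f g) ∧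
      LatticeLS.worstCaseError r (LatticeLS.leastSquares z B j) ^ 2 ≤
        (⨆ h : ↥Bᶜ, ENNReal.ofReal (1 / r h)) +
        ENNReal.ofReal (42 * (Real.log m + t) / m) * (∑' h : ↥Bᶜ, ENNReal.ofReal (1 / r h)) +
        ENNReal.ofReal (4 / n) * LatticeLS.specNorm (LatticeLS.phiMatrix r n z B) ^ 2)
    fun j hj₁ hj₂ => ?_
  simp only [not_exists, not_lt, ← LatticeLS.norm_sampling_sq] at hj₁
  exact ⟨LatticeLS.existsUnique_isLeastSquares
    (LatticeLS.sampling_injective (by positivity) hj₁), herr j hj₂ hj₁⟩
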